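/- Let $G=(V,E)$ be an undirected graph with $V=\{1,\dots,N\}$, $N\ge 1$, and let $W\in[0,1]^{N\times N}$ be a mixing matrix on $G$: $W=W^\top$, $W\mathbf 1=\mathbf 1$, and $W_{ij}=0$ whenever $i\ne j$ and $(i,j)\notin E$. Let $\mathcal N_i^+$ consist of $i$ and its neighbours. Node $i$ has a data distribution $\mathcal D_i$ and losses $F_i(x;\xi)$, $x\in\mathbb R^d$, differentiable in $x$; put $f_i(x):=\mathbb E_{\xi\sim\mathcal D_i}F_i(x;\xi)$, $\nabla f_i(x):=\mathbb E_{\xi\sim\mathcal D_i}\nabla F_i(x;\xi)$ (these expectations are assumed to exist) and $f:=\frac1N\sum_{i=1}^N f_i$. Assume: (1) $f(x)\ge f^\star>-\infty$ for all $x\in\mathbb R^d$; (2) for some $p\in(0,1]$, $\|XW-\bar X\|_F^2\le(1-p)\|X-\bar X\|_F^2$ for all $X\in\mathbb R^{d\times N}$, where $\bar X:=\frac1N X\mathbf 1\mathbf 1^\top$; (3) for some $L>0$, $\|\nabla f_i(x)-\nabla f_i(y)\|\le L\|x-y\|$ for all $i,x,y$; (4) for some $\sigma$, $\mathbb E_{\xi\sim\mathcal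 D_i}\|\nabla F_i(x;\xi)-\nabla f_i(x)\|^2\le\sigma^2$ for all $i,x$. Let $\xi_i^{(r)}\sim\mathcal D_i$ ($1\le i\le N$, $r\ge 0$) be independent samples. For $\beta\in[0,1)$ and a step size $\eta$, Momentum Tracking starts from a common parameter $x_i^{(0)}=x^{(0)}$ and from $$u_i^{(0)}=c_i^{(0)}=\frac1{1-\beta}\Big(\nabla F_i(x_i^{(0)};\xi_i^{(0)})-\frac1N\sum_{j=1}^N\nabla F_j(x_j^{(0)};\xi_j^{(0)})\Big),$$ and iterates $$u_i^{(r+1)}=\beta u_i^{(r)}+\nabla F_i(x_i^{(r)};\xi_i^{(r)}),\qquad x_i^{(r+1)}=\sum_{j\in\mathcal N_i^+}W_{ij}x_j^{(r)}-\eta\big(u_i^{(r+1)}-c_i^{(r)}\big),$$ $$c_i^{(r+1)}=\sum_{j\in\mathcal N_i^+}W_{ij}\big(c_j^{(r)}-u_j^{(r+1)}\big)+u_i^{(r+1)}.$$ Let $\bar x^{(r)}:=\frac1N\sum_{i=1}^N x_i^{(r)}$ and $r_0:=f(\bar x^{(0)})-f^\star$. Then $f$ is differentiable with $\nabla f=\frac1N\sum_i\nabla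 f_i$, and there is an absolute constant $C>0$ (the same for all the data above) such that for every $\beta\in[0,1)$ and every integer $R\ge1$ there is a step size $\eta\ge0$, with $\eta>0$ if $r_0>0$, for which $$\frac1R\sum_{r=0}^{R-1}\mathbb E\big\|\nabla f(\bar x^{(r)})\big\|^2\le C\left(\sqrt{\frac{r_0\sigma^2L}{NR}}+\left(\frac{r_0^2\sigma^2L^2}{p^4R^2(1-\beta)}\Big(1+\frac{p\beta^2}{1-\beta}\Big)\right)^{1/3}+\frac{Lr_0}{(1-\beta)p^2R}\sqrt{1+\frac{\beta^2}{(1-\beta^2)^3p}}\right),$$ where each expectation on the left is finite. No bound on the heterogeneity of the $\nabla f_i$ (such as $\frac1N\sum_i\|\nabla f_i(x)-\nabla f(x)\|^2\le\zeta^2$) is assumed. -/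

import Mathlib

open MeasureTheory ProbabilityTheory

namespace MomentumTracking

/-- The parameter space `ℝ^d` with the Euclidean norm. -/
abbrev Param (d : ℕ) : Type := EuclideanSpace ℝ (Fin d)

noncomputable section

/-- The average `(1/N) ∑ i, a i` over the `N` nodes. -/
def nodeAvg {N d : ℕ} (a : Fin N → Param d) : Param d :=
  (N : ℝ)⁻¹ • ∑ i, a i

/-! ### The network -/

/-- `W` is a mixing matrix on the graph `G`: its entries lie in `[0, 1]` and vanish outside the
edges and the diagonal, it is symmetric, and its rows sum to one. -/
structure IsMixingMatrix {N : ℕ} (G : SimpleGraph (Fin N)) (W : Matrix (Fin N) (Fin N) ℝ) :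
    Prop where
  mem_Icc : ∀ i j, W i j ∈ Set.Icc (0 : ℝ) 1
  supported : ∀ i j, i ≠ j → ¬ G.Adj i j → W i j = 0
  symm : ∀ i j, W i j = W j i
  row_sum : ∀ i, ∑ j, W i j = 1

/-- `‖X W - X̄‖_F² ≤ (1 - p) ‖X - X̄‖_F²` for every matrix `X` with columns `x 1, …, x N` in
`ℝ^d`; the squared Frobenius norm is the sum of the squared norms of the columns. -/
def Contracts {N : ℕ} (W : Matrix (Fin N) (Fin N) ℝ) (d : ℕ) (p : ℝ) : Prop :=
  ∀ x : Fin N → Param d,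
    ∑ i, ‖(∑ j, W j i • x j) - nodeAvg x‖ ^ 2 ≤ (1 - p) * ∑ i, ‖x i - nodeAvg x‖ ^ 2

open Classical in
/-- `∑ W i j • a j` over the closed neighbourhood of the node `i` in `G`. -/
def gossip {N d : ℕ} (G : SimpleGraph (Fin N)) (W : Matrix (Fin N) (Fin N) ℝ)
    (a : Fin N → Param d) (i : Fin N) : Param d :=
  ∑ j ∈ Finset.univ.filter (fun j => j = i ∨ G.Adj i j), W i j • a j

/-! ### The objective functions

Node `i` has the data space `S i`, the data distribution `D i` on it, and the loss `F i x s` of the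
parameter `x` on the sample `s`. -/

section Objective

variable {N d : ℕ} {S : Fin N → Type*}

/-- The stochastic gradient `∇F_i(x; s)`, the gradient being taken in `x`. -/
def stochGrad (F : ∀ i, Param d → S i → ℝ) (i : Fin N) (x : Param d) (s : S i) : Param d :=
  gradient (fun y => F i y s) x

variable [∀ i, MeasurableSpace (S i)]

/-- The local objective `f_i(x) = E_{s ∼ D_i} F_i(x; s)`. -/
def localObj (D : ∀ i, Measure (S i)) (F : ∀ i, Param d → S i → ℝ) (i : Fin N) (x : Param d) : ℝ :=
  ∫ s, F i x s ∂(D i)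

/-- The full local gradient `∇f_i(x) = E_{s ∼ D_i} ∇F_i(x; s)`. -/
def localGrad (D : ∀ i, Measure (S i)) (F : ∀ i, Param d → S i → ℝ) (i : Fin N) (x : Param d) :
    Param d :=
  ∫ s, stochGrad F i x s ∂(D i)

/-- The global objective `f(x) = (1/N) ∑ i, f_i(x)`. -/
def globalObj (D : ∀ i, Measure (S i)) (F : ∀ i, Param d → S i → ℝ) (x : Param d) : ℝ :=
  (N : ℝ)⁻¹ * ∑ i, localObj D F i x

/-- The losses are differentiable in the parameter and measurable in the sample, and the
expectations that define `f_i` and `∇f_i` exist. -/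
structure IsRegular (D : ∀ i, Measure (S i)) (F : ∀ i, Param d → S i → ℝ) : Prop where
  differentiable : ∀ i s, Differentiable ℝ (fun x => F i x s)
  measurable : ∀ i x, Measurable (F i x)
  integrable : ∀ i x, Integrable (F i x) (D i)
  integrable_grad : ∀ i x, Integrable (stochGrad F i x) (D i)

/-- Every `∇f_i` is `L`-Lipschitz. -/
def IsSmooth (D : ∀ i, Measure (S i)) (F : ∀ i, Param d → S i → ℝ) (L : ℝ) : Prop :=
  ∀ i x y, ‖localGrad D F i x - localGrad D F i y‖ ≤ L * ‖x - y‖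

/-- The stochastic gradients have variance at most `σ²`. -/
def HasVarianceBound (D : ∀ i, Measure (S i)) (F : ∀ i, Param d → S i → ℝ) (σ : ℝ) : Prop :=
  ∀ i x, Integrable (fun s => ‖stochGrad F i x s - localGrad D F i x‖ ^ 2) (D i) ∧
    ∫ s, ‖stochGrad F i x s - localGrad D F i x‖ ^ 2 ∂(D i) ≤ σ ^ 2

end Objective

/-! ### The algorithm -/

/-- The variables of all nodes: momenta `u`, parameters `x` and corrections `c`. -/
structure State (N d : ℕ) where
  u : Fin N → Param d
  x : Fin N → Param d
  c : Fin N → Param d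

section Algorithm

variable {N d : ℕ} {S : Fin N → Type*}

/-- The common initial value `(1/(1-β)) (∇F_i(x₀; s_i) - (1/N) ∑ j, ∇F_j(x₀; s_j))` of `u i` and
`c i`. -/
def initValue (F : ∀ i, Param d → S i → ℝ) (β : ℝ) (x₀ : Param d) (s : ∀ i, S i) (i : Fin N) :
    Param d :=
  (1 - β)⁻¹ • (stochGrad F i x₀ (s i) - nodeAvg (fun j => stochGrad F j x₀ (s j)))

/-- The momenta after a round that starts in the state `st` and uses the samples `s`. -/
def nextU (F : ∀ i, Param d → S i → ℝ) (β : ℝ) (s : ∀ i, S i) (st : State N d) (i : Fin N) :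
    Param d :=
  β • st.u i + stochGrad F i (st.x i) (s i)

/-- One round of Momentum Tracking. -/
def step (F : ∀ i, Param d → S i → ℝ) (G : SimpleGraph (Fin N)) (W : Matrix (Fin N) (Fin N) ℝ)
    (η β : ℝ) (s : ∀ i, S i) (st : State N d) : State N d where
  u := nextU F β s st
  x := fun i => gossip G W st.x i - η • (nextU F β s st i - st.c i)
  c := fun i => gossip G W (fun j => st.c j - nextU F β s st j) i + nextU F β s st i

/-- The iterates of Momentum Tracking along the samples `s i r` (node `i`, round `r`), all nodes
starting in `x₀`. -/
def iterate (F : ∀ i, Param d → S i → ℝ) (G : SimpleGraph (Fin N)) (W : Matrix (Fin N) (Fin N) ℝ)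
    (η β : ℝ) (x₀ : Param d) (s : ∀ i, ℕ → S i) : ℕ → State N d
  | 0 =>
    { u := initValue F β x₀ (fun i => s i 0)
      x := fun _ => x₀
      c := initValue F β x₀ (fun i => s i 0) }
  | r + 1 => step F G W η β (fun i => s i r) (iterate F G W η β x₀ s r)

/-- The average parameter `x̄^(r)`. -/
def avgParam (F : ∀ i, Param d → S i → ℝ) (G : SimpleGraph (Fin N)) (W : Matrix (Fin N) (Fin N) ℝ)
    (η β : ℝ) (x₀ : Param d) (s : ∀ i, ℕ → S i) (r : ℕ) : Param d :=
  nodeAvg (iterate F G W η β x₀ s r).x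

end Algorithm

/-- The samples `ξ i r` (node `i`, round `r`) are independent, and `ξ i r` has the law `D i`. -/
structure IsSampling {N : ℕ} {S : Fin N → Type*} [∀ i, MeasurableSpace (S i)]
    {Ω : Type*} [MeasurableSpace Ω] (P : Measure Ω) (D : ∀ i, Measure (S i))
    (ξ : ∀ i, ℕ → Ω → S i) : Prop where
  measurable : ∀ i r, Measurable (ξ i r)
  law : ∀ i r, P.map (ξ i r) = D i
  indep : iIndepFun (β := fun k : Fin N × ℕ => S k.1) (fun k => ξ k.1 k.2) P

/-- The rate, without its absolute constant. -/
def rate (N R : ℕ) (p L σ β r₀ : ℝ) : ℝ :=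
  Real.sqrt (r₀ * σ ^ 2 * L / (N * R))
    + (r₀ ^ 2 * σ ^ 2 * L ^ 2 / (p ^ 4 * (R : ℝ) ^ 2 * (1 - β))
        * (1 + p * β ^ 2 / (1 - β))) ^ ((1 : ℝ) / 3)
    + L * r₀ / ((1 - β) * p ^ 2 * R) * Real.sqrt (1 + β ^ 2 / ((1 - β ^ 2) ^ 3 * p))

end

end MomentumTracking

/-! The argument has a deterministic half, valid on every sample path, and a stochastic half; both
are governed by the effective step size `a = η / (1 - β)`.

Averages. The corrections `c` average to zero, so the averaged iterate is plain momentum descent,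
and the virtual iterate `x̄ - aβ ū` moves by exactly `-a` times the averaged stochastic gradient
(`IsRun.virtual_succ`). The descent inequality is applied along the virtual iterates
(`IsModel.descent`). Two errors arise: the distance from the virtual iterate to `x̄`, a multiple of
`ū`, and the consensus distance `sqDev (x r)`.

Consensus without a heterogeneity bound. The directions `u (r + 1) - c r` satisfy a gossip recursion
driven only by momentum increments, which are in turn driven by the increments `g (r + 1) i - g r i`
of each node's own gradient. Gradients of different nodes are never compared: smoothness turns an
increment into movement of that node's parameter plus noise. The prescribed initial values make the
first direction common to all nodes (`IsRun.first_direction`), so no initial error survives. Summing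
three contractions, with rates `p / 2`, `p / 2` and `1 - β`, bounds the accumulated consensus
distance by itself, the averaged gradients and the noise; for `36 L a ≤ p²` the self-reference is
absorbed (`IsRun.sum_sqDev_x_le_of_stepsize`).

Expectations. Each parameter entering a gradient in round `r` depends on earlier samples only. Hence
the noise is orthogonal to the gradient at the virtual iterate, and noises of different nodes are
orthogonal, which gives variance `σ² / N` for the averaged noise. The bounds are combined in
`rate_of_accumulated_bounds`, and `exists_stepsize` balances the resulting three terms in `a`. -/

namespace MomentumTracking

noncomputable section

open Filter Topology

/-! ### Differentiating the expected loss -/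

section Gradient

variable {d : ℕ} {T : Type*} [MeasurableSpace T]

theorem inner_gradient_eq_fderiv {f : Param d → ℝ} (x v : Param d) :
    inner ℝ (gradient f x) v = fderiv ℝ f x v := by
  simp [gradient]

/-- Joint measurability comes from difference quotients along `v` with increments `1 / (n + 1)`: the
loss is continuous in the parameter and measurable in the sample, hence jointly measurable, and the
quotients converge pointwise. -/
theorem measurable_inner_gradient {F : Param d → T → ℝ}
    (hd : ∀ s, Differentiable ℝ (fun x => F x s)) (hm : ∀ x, Measurable (F x)) (v : Param d) :
    Measurable (fun q : Param d × T => inner ℝ (gradient (fun y => F y q.2) q.1) v) := by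
  have hF : Measurable (Function.uncurry F) :=
    measurable_uncurry_of_continuous_of_measurable (fun s => (hd s).continuous) hm
  refine measurable_of_tendsto_metrizable
    (f := fun n q => ((n : ℝ) + 1) • (F (q.1 + ((n : ℝ) + 1)⁻¹ • v) q.2 - F q.1 q.2)) ?_ ?_
  · intro n
    have h1 : Measurable (fun q : Param d × T => F (q.1 + ((n : ℝ) + 1)⁻¹ • v) q.2) :=
      hF.comp (f := fun q : Param d × T => (q.1 + ((n : ℝ) + 1)⁻¹ • v, q.2)) (by fun_prop)
    exact (h1.sub hF).const_mul ((n : ℝ) + 1)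
  · rw [tendsto_pi_nhds]
    intro q
    rw [inner_gradient_eq_fderiv]
    refine ((hd q.2) q.1).hasFDerivAt.lim v ?_
    refine tendsto_norm_atTop_atTop.comp ?_
    exact tendsto_atTop_add_const_right _ _ tendsto_natCast_atTop_atTop

theorem measurable_gradient {F : Param d → T → ℝ}
    (hd : ∀ s, Differentiable ℝ (fun x => F x s)) (hm : ∀ x, Measurable (F x)) :
    Measurable (fun q : Param d × T => gradient (fun y => F y q.2) q.1) := by
  have : (fun q : Param d × T => gradient (fun y => F y q.2) q.1) = fun q =>
      ∑ k, inner ℝ (gradient (fun y => F y q.2) q.1) (EuclideanSpace.basisFun (Fin d) ℝ k) •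
        EuclideanSpace.basisFun (Fin d) ℝ k := by
    funext q
    conv_lhs => rw [← (EuclideanSpace.basisFun (Fin d) ℝ).sum_repr' (gradient _ q.1)]
    simp only [real_inner_comm]
  rw [this]
  exact Finset.measurable_fun_sum _ fun k _ => (measurable_inner_gradient hd hm _).smul_const _

/-- The expected objective differs from its linearization by at most `L ‖h‖²`. -/
theorem abs_integral_sub_linearization_le {μ : Measure T} [IsProbabilityMeasure μ]
    {F : Param d → T → ℝ} (hd : ∀ s, Differentiable ℝ (fun x => F x s))
    (hm : ∀ x, Measurable (F x)) (hi : ∀ x, Integrable (F x) μ)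
    (hg : ∀ x, Integrable (fun s => gradient (fun y => F y s) x) μ) {L σ : ℝ} (hL : 0 ≤ L)
    (hlip : ∀ x y, ‖(∫ s, gradient (fun y => F y s) x ∂μ) - ∫ s, gradient (fun z => F z s) y ∂μ‖
      ≤ L * ‖x - y‖)
    (hvar : ∀ x, Integrable (fun s => ‖gradient (fun y => F y s) x -
        ∫ s, gradient (fun y => F y s) x ∂μ‖ ^ 2) μ ∧
      ∫ s, ‖gradient (fun y => F y s) x - ∫ s, gradient (fun y => F y s) x ∂μ‖ ^ 2 ∂μ ≤ σ ^ 2)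
    (x h : Param d) :
    |(∫ s, F (x + h) s ∂μ) - (∫ s, F x s ∂μ)
      - inner ℝ (∫ s, gradient (fun y => F y s) x ∂μ) h| ≤ L * ‖h‖ ^ 2 := by
  set g : Param d → T → Param d := fun x s => gradient (fun y => F y s) x with hgdef
  set q : Param d → Param d := fun x => ∫ s, g x s ∂μ with hq
  have hqlip : LipschitzWith ⟨L, hL⟩ q := LipschitzWith.of_dist_le_mul fun a b => by
    rw [dist_eq_norm, dist_eq_norm]; exact hlip a b
  have hqc : Continuous q := hqlip.continuous
  have hgi : ∀ y, Integrable (g y) μ := hg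
  have hii : ∀ y, Integrable (fun s => inner ℝ (g y s) h) μ := fun y => (hgi y).inner_const h
  have hvi : ∀ y, Integrable (fun s => ‖g y s - q y‖ ^ 2) μ := fun y => (hvar y).1
  have hvb : ∀ y, ∫ s, ‖g y s - q y‖ ^ 2 ∂μ ≤ σ ^ 2 := fun y => (hvar y).2
  -- No dominating function for the gradients is available, so differentiation under the integral is
  -- avoided. Instead the variance bound controls the first moment at each point, through `t ≤ 1 +
  -- t²`, locally uniformly because `q` is continuous.
  have hmom : ∀ y, ∫ s, ‖g y s‖ ∂μ ≤ ‖q y‖ + (1 + σ ^ 2) := by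
    intro y
    have h1 : ∀ s, ‖g y s‖ ≤ ‖q y‖ + (1 + ‖g y s - q y‖ ^ 2) := by
      intro s
      have : ‖g y s‖ ≤ ‖q y‖ + ‖g y s - q y‖ := by
        simpa using norm_add_le (q y) (g y s - q y)
      nlinarith [sq_nonneg (‖g y s - q y‖ - 1), sq_nonneg (‖g y s - q y‖)]
    calc ∫ s, ‖g y s‖ ∂μ ≤ ∫ s, (‖q y‖ + (1 + ‖g y s - q y‖ ^ 2)) ∂μ :=
          integral_mono (hgi y).norm
            ((integrable_const _).add ((integrable_const _).add (hvi y))) h1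
      _ = ‖q y‖ + (1 + ∫ s, ‖g y s - q y‖ ^ 2 ∂μ) := by
          simp only [← add_assoc]
          rw [integral_add (integrable_const _) (hvi y)]
          simp
      _ ≤ _ := by linarith [hvb y]
  set ν : Measure ℝ := volume.restrict (Set.Ioc 0 1) with hν
  have hφm : Measurable (Function.uncurry fun (t : ℝ) (s : T) => inner ℝ (g (x + t • h) s) h) :=
    (measurable_inner_gradient hd hm h).comp (f := fun r : ℝ × T => (x + r.1 • h, r.2))
      (by fun_prop)
  have hbd : ∀ t : ℝ, ∫ s, ‖inner ℝ (g (x + t • h) s) h‖ ∂μ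
      ≤ (‖q (x + t • h)‖ + (1 + σ ^ 2)) * ‖h‖ := by
    intro t
    calc _ ≤ ∫ s, ‖g (x + t • h) s‖ * ‖h‖ ∂μ :=
          integral_mono (hii (x + t • h)).norm ((hgi (x + t • h)).norm.mul_const _)
            fun s => norm_inner_le_norm _ _
      _ = (∫ s, ‖g (x + t • h) s‖ ∂μ) * ‖h‖ := integral_mul_const _ _
      _ ≤ _ := mul_le_mul_of_nonneg_right (hmom _) (norm_nonneg _)
  have hprod : Integrable (Function.uncurry fun (t : ℝ) (s : T) => inner ℝ (g (x + t • h) s) h)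
      (ν.prod μ) := by
    rw [integrable_prod_iff hφm.aestronglyMeasurable]
    refine ⟨ae_of_all _ fun t => hii (x + t • h), ?_⟩
    refine Integrable.mono' (g := fun t => (‖q (x + t • h)‖ + (1 + σ ^ 2)) * ‖h‖) ?_ ?_ ?_
    · have hc : Continuous fun t : ℝ => (‖q (x + t • h)‖ + (1 + σ ^ 2)) * ‖h‖ := by fun_prop
      exact hc.integrableOn_Ioc
    · exact (hφm.norm.stronglyMeasurable.integral_prod_right').aestronglyMeasurable
    · refine ae_of_all _ fun t => ?_
      rw [Real.norm_of_nonneg (integral_nonneg fun _ => norm_nonneg _)]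
      exact hbd t
  -- For almost every sample the derivative along the segment is integrable by Fubini, which
  -- suffices for the fundamental theorem of calculus; continuity of the gradient of a single loss
  -- is not needed.
  have hftc : ∀ᵐ s ∂μ, ∫ t, inner ℝ (g (x + t • h) s) h ∂ν = F (x + h) s - F x s := by
    filter_upwards [hprod.prod_left_ae] with s hs
    have hder : ∀ t ∈ Set.uIcc (0 : ℝ) 1,
        HasDerivAt (fun t => F (x + t • h) s) (inner ℝ (g (x + t • h) s) h) t := by
      intro t _
      have h1 : HasDerivAt (fun t : ℝ => x + t • h) h t := by
        simpa using ((hasDerivAt_id t).smul_const h).const_add x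
      have h2 := ((hd s) (x + t • h)).hasFDerivAt.comp_hasDerivAt t h1
      rw [hgdef, inner_gradient_eq_fderiv]
      exact h2
    have := intervalIntegral.integral_eq_sub_of_hasDerivAt hder
      ((intervalIntegrable_iff_integrableOn_Ioc_of_le zero_le_one).2 hs)
    rw [intervalIntegral.integral_of_le zero_le_one] at this
    simpa using this
  have hswap : ∫ t, inner ℝ (q (x + t • h)) h ∂ν
      = (∫ s, F (x + h) s ∂μ) - ∫ s, F x s ∂μ := by
    rw [← integral_sub (hi (x + h)) (hi x), ← integral_congr_ae hftc, ← integral_integral_swap hprod]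
    refine integral_congr_ae (ae_of_all _ fun t => ?_)
    simp only [real_inner_comm h]
    exact (integral_inner (hgi (x + t • h)) h).symm
  have hci : Integrable (fun t => inner ℝ (q (x + t • h)) h) ν := by
    have hc : Continuous fun t : ℝ => inner ℝ (q (x + t • h)) h := by fun_prop
    exact hc.integrableOn_Ioc
  have : IsProbabilityMeasure ν := ⟨by simp [hν]⟩
  have hrem : (∫ s, F (x + h) s ∂μ) - (∫ s, F x s ∂μ) - inner ℝ (q x) h
      = ∫ t, (inner ℝ (q (x + t • h)) h - inner ℝ (q x) h) ∂ν := by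
    rw [integral_sub hci (integrable_const _), hswap]; simp
  rw [hrem, ← Real.norm_eq_abs]
  -- The integrand is at most `t L ‖h‖²`; bounding `t` by `1` gives `L` in place of the sharp `L /
  -- 2`, which affects only the absolute constant.
  have := norm_integral_le_of_norm_le_const (μ := ν) (C := L * ‖h‖ ^ 2)
    (f := fun t => inner ℝ (q (x + t • h)) h - inner ℝ (q x) h) (by
      rw [hν, ae_restrict_iff' measurableSet_Ioc]
      refine ae_of_all _ fun t ht => ?_
      rw [← inner_sub_left]
      have h2 : ‖q (x + t • h) - q x‖ ≤ L * ‖h‖ := by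
        refine (hlip _ _).trans ?_
        rw [add_sub_cancel_left, norm_smul, Real.norm_of_nonneg ht.1.le]
        exact mul_le_mul_of_nonneg_left
          (mul_le_of_le_one_left (norm_nonneg _) ht.2) hL
      refine (norm_inner_le_norm _ _).trans ?_
      calc _ ≤ (L * ‖h‖) * ‖h‖ := mul_le_mul_of_nonneg_right h2 (norm_nonneg _)
        _ = _ := by ring)
  simpa using this

/-- A quadratic bound on the linearization error makes `v` the gradient. -/
theorem hasGradientAt_of_abs_sub_le {f : Param d → ℝ} {v x : Param d} {L : ℝ}
    (h : ∀ y, |f (x + y) - f x - inner ℝ v y| ≤ L * ‖y‖ ^ 2) : HasGradientAt f v x := by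
  rw [hasGradientAt_iff_isLittleO_nhds_zero]
  have h1 : (fun y => f (x + y) - f x - inner ℝ v y) =O[𝓝 0] fun y : Param d => ‖y‖ ^ 2 :=
    Asymptotics.IsBigO.of_bound L (Eventually.of_forall fun y => by
      simpa using h y)
  refine h1.trans_isLittleO ?_
  exact Asymptotics.isLittleO_norm_pow_id one_lt_two

end Gradient

section Objective

variable {N d : ℕ} {S : Fin N → Type*} [∀ i, MeasurableSpace (S i)]
  {D : ∀ i, Measure (S i)} [∀ i, IsProbabilityMeasure (D i)] {F : ∀ i, Param d → S i → ℝ}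

theorem abs_localObj_sub_linearization_le (hF : IsRegular D F) {L σ : ℝ} (hL : 0 ≤ L)
    (hs : IsSmooth D F L) (hv : HasVarianceBound D F σ) (i : Fin N) (x h : Param d) :
    |localObj D F i (x + h) - localObj D F i x - inner ℝ (localGrad D F i x) h|
      ≤ L * ‖h‖ ^ 2 :=
  abs_integral_sub_linearization_le (hF.differentiable i) (hF.measurable i) (hF.integrable i)
    (hF.integrable_grad i) hL (hs i) (hv i) x h

/-- The gradient of the global objective. -/
def globalGrad (D : ∀ i, Measure (S i)) (F : ∀ i, Param d → S i → ℝ) (x : Param d) : Param d :=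
  nodeAvg (fun i => localGrad D F i x)

/-- This bound is used twice: it identifies the gradient of the objective, and its upper half is the
descent inequality. -/
theorem abs_globalObj_sub_linearization_le (hN : 0 < N) (hF : IsRegular D F) {L σ : ℝ}
    (hL : 0 ≤ L) (hs : IsSmooth D F L) (hv : HasVarianceBound D F σ) (x h : Param d) :
    |globalObj D F (x + h) - globalObj D F x - inner ℝ (globalGrad D F x) h|
      ≤ L * ‖h‖ ^ 2 := by
  have hN' : (0 : ℝ) < N := by exact_mod_cast hN
  have : globalObj D F (x + h) - globalObj D F x - inner ℝ (globalGrad D F x) h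
      = (N : ℝ)⁻¹ * ∑ i, (localObj D F i (x + h) - localObj D F i x
          - inner ℝ (localGrad D F i x) h) := by
    simp only [globalObj, globalGrad, nodeAvg, real_inner_smul_left, sum_inner,
      Finset.sum_sub_distrib]
    ring
  rw [this, abs_mul, abs_of_pos (inv_pos.2 hN'), inv_mul_le_iff₀ hN']
  calc _ ≤ ∑ i, |localObj D F i (x + h) - localObj D F i x - inner ℝ (localGrad D F i x) h| :=
        Finset.abs_sum_le_sum_abs _ _
    _ ≤ ∑ _i : Fin N, L * ‖h‖ ^ 2 :=
        Finset.sum_le_sum fun i _ => abs_localObj_sub_linearization_le hF hL hs hv i x h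
    _ = _ := by simp

theorem hasGradientAt_globalObj (hN : 0 < N) (hF : IsRegular D F) {L σ : ℝ}
    (hL : 0 ≤ L) (hs : IsSmooth D F L) (hv : HasVarianceBound D F σ) (x : Param d) :
    HasGradientAt (globalObj D F) (globalGrad D F x) x :=
  hasGradientAt_of_abs_sub_le (abs_globalObj_sub_linearization_le hN hF hL hs hv x)

end Objective

end

end MomentumTracking

namespace MomentumTracking

noncomputable section

/-! ### Node averages and the consensus distance -/

section Averages

variable {N d : ℕ}

theorem nodeAvg_add (a b : Fin N → Param d) :
    nodeAvg (fun i => a i + b i) = nodeAvg a + nodeAvg b := by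
  simp [nodeAvg, Finset.sum_add_distrib]

theorem nodeAvg_sub (a b : Fin N → Param d) :
    nodeAvg (fun i => a i - b i) = nodeAvg a - nodeAvg b := by
  simp [nodeAvg, Finset.sum_sub_distrib, smul_sub]

theorem nodeAvg_smul (c : ℝ) (a : Fin N → Param d) :
    nodeAvg (fun i => c • a i) = c • nodeAvg a := by
  simp only [nodeAvg, ← Finset.smul_sum]
  rw [smul_comm]

theorem nodeAvg_const (hN : 0 < N) (v : Param d) : nodeAvg (fun _ : Fin N => v) = v := by
  have : (N : ℝ) ≠ 0 := by exact_mod_cast hN.ne'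
  simp only [nodeAvg, Finset.sum_const, Finset.card_univ, Fintype.card_fin,
    ← Nat.cast_smul_eq_nsmul ℝ, smul_smul]
  rw [inv_mul_cancel₀ this, one_smul]

theorem sum_sub_nodeAvg (hN : 0 < N) (a : Fin N → Param d) : ∑ i, (a i - nodeAvg a) = 0 := by
  have h := nodeAvg_sub a (fun _ => nodeAvg a)
  rw [nodeAvg_const hN, sub_self] at h
  have : (N : ℝ) ≠ 0 := by exact_mod_cast hN.ne'
  simpa [nodeAvg, this] using h

/-- The average of all nodes minimizes the sum of the squared distances to the nodes. -/
theorem sum_sq_sub_nodeAvg (hN : 0 < N) (a : Fin N → Param d) :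
    ∑ i, ‖a i - nodeAvg a‖ ^ 2 = ∑ i, ‖a i‖ ^ 2 - N * ‖nodeAvg a‖ ^ 2 := by
  have h1 : ∀ i, ‖a i‖ ^ 2 = ‖a i - nodeAvg a‖ ^ 2 + 2 * inner ℝ (a i - nodeAvg a) (nodeAvg a)
      + ‖nodeAvg a‖ ^ 2 := fun i => by
    rw [← norm_add_sq_real, sub_add_cancel]
  simp only [h1, Finset.sum_add_distrib, ← Finset.mul_sum, ← sum_inner, sum_sub_nodeAvg hN]
  simp

/-- The squared consensus distance `‖A - Ā‖_F²`. -/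
def sqDev (a : Fin N → Param d) : ℝ := ∑ i, ‖a i - nodeAvg a‖ ^ 2

theorem sqDev_nonneg (a : Fin N → Param d) : 0 ≤ sqDev a :=
  Finset.sum_nonneg fun _ _ => sq_nonneg _

theorem sqDev_le_sum_sq (hN : 0 < N) (a : Fin N → Param d) : sqDev a ≤ ∑ i, ‖a i‖ ^ 2 := by
  rw [sqDev, sum_sq_sub_nodeAvg hN]
  have : 0 ≤ (N : ℝ) * ‖nodeAvg a‖ ^ 2 := by positivity
  linarith

theorem mul_sq_norm_nodeAvg_le (hN : 0 < N) (a : Fin N → Param d) :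
    N * ‖nodeAvg a‖ ^ 2 ≤ ∑ i, ‖a i‖ ^ 2 := by
  have := sqDev_nonneg a
  rw [sqDev, sum_sq_sub_nodeAvg hN] at this
  linarith

theorem sqDev_const (hN : 0 < N) (v : Param d) : sqDev (fun _ : Fin N => v) = 0 := by
  simp [sqDev, nodeAvg_const hN]

theorem sqDev_smul (c : ℝ) (a : Fin N → Param d) :
    sqDev (fun i => c • a i) = c ^ 2 * sqDev a := by
  simp only [sqDev, nodeAvg_smul, ← smul_sub, norm_smul, mul_pow, Finset.mul_sum,
    Real.norm_eq_abs, sq_abs]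

/-- Convexity of the squared norm, for the weights `t` and `1 - t`. -/
theorem sq_norm_add_le {E : Type*} [NormedAddCommGroup E] [InnerProductSpace ℝ E] {t : ℝ}
    (ht : 0 < t) (ht1 : t < 1) (v w : E) :
    ‖v + w‖ ^ 2 ≤ t⁻¹ * ‖v‖ ^ 2 + (1 - t)⁻¹ * ‖w‖ ^ 2 := by
  have h1 : ‖v + w‖ ^ 2 ≤ (‖v‖ + ‖w‖) ^ 2 := by gcongr; exact norm_add_le v w
  have h2 : (‖v‖ + ‖w‖) ^ 2 ≤ t⁻¹ * ‖v‖ ^ 2 + (1 - t)⁻¹ * ‖w‖ ^ 2 := by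
    have h3 : 0 < 1 - t := by linarith
    rw [← sub_nonneg]
    have : t⁻¹ * ‖v‖ ^ 2 + (1 - t)⁻¹ * ‖w‖ ^ 2 - (‖v‖ + ‖w‖) ^ 2
        = t⁻¹ * (1 - t)⁻¹ * ((1 - t) * ‖v‖ - t * ‖w‖) ^ 2 := by
      field_simp
      ring
    rw [this]
    positivity
  exact h1.trans h2

theorem sqDev_add_le {t : ℝ} (ht : 0 < t) (ht1 : t < 1) (a b : Fin N → Param d) :
    sqDev (fun i => a i + b i) ≤ t⁻¹ * sqDev a + (1 - t)⁻¹ * sqDev b := by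
  simp only [sqDev, nodeAvg_add, Finset.mul_sum, ← Finset.sum_add_distrib]
  refine Finset.sum_le_sum fun i _ => ?_
  rw [add_sub_add_comm]
  exact sq_norm_add_le ht ht1 _ _

/-- Convexity with weights `β` and `1 - β`. The factor is written `1 - (1 - β)` to fit
`sum_le_of_contraction` with rate `1 - β`; the weight must be positive, so `β = 0` is treated apart.
-/
theorem sq_norm_smul_add_le {E : Type*} [NormedAddCommGroup E] [InnerProductSpace ℝ E] {β : ℝ}
    (h0 : 0 ≤ β) (h1 : β < 1) (v w : E) :
    ‖β • v + w‖ ^ 2 ≤ (1 - (1 - β)) * ‖v‖ ^ 2 + (1 - β)⁻¹ * ‖w‖ ^ 2 := by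
  rcases h0.eq_or_lt with rfl | h0
  · simp
  · have := sq_norm_add_le h0 h1 (β • v) w
    rw [norm_smul, Real.norm_of_nonneg h0.le, mul_pow] at this
    have h2 : β⁻¹ * (β ^ 2 * ‖v‖ ^ 2) = (1 - (1 - β)) * ‖v‖ ^ 2 := by field_simp; ring
    linarith

theorem sqDev_smul_add_le {β : ℝ} (h0 : 0 ≤ β) (h1 : β < 1) (a b : Fin N → Param d) :
    sqDev (fun i => β • a i + b i) ≤ (1 - (1 - β)) * sqDev a + (1 - β)⁻¹ * sqDev b := by
  simp only [sqDev, nodeAvg_add, nodeAvg_smul, Finset.mul_sum, ← Finset.sum_add_distrib]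
  refine Finset.sum_le_sum fun i _ => ?_
  rw [add_sub_add_comm, ← smul_sub]
  exact sq_norm_smul_add_le h0 h1 _ _

end Averages

/-! ### Gossip averaging -/

section Mixing

variable {N d : ℕ} {G : SimpleGraph (Fin N)} {W : Matrix (Fin N) (Fin N) ℝ}

theorem gossip_eq_sum (hW : IsMixingMatrix G W) (a : Fin N → Param d) (i : Fin N) :
    gossip G W a i = ∑ j, W i j • a j := by
  classical
  rw [gossip, Finset.sum_filter]
  refine Finset.sum_congr rfl fun j _ => ?_
  split_ifs with h
  · rfl
  · rw [not_or] at h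
    rw [hW.supported i j (Ne.symm h.1) h.2, zero_smul]

theorem nodeAvg_mix (hW : IsMixingMatrix G W) (a : Fin N → Param d) :
    nodeAvg (fun i => ∑ j, W i j • a j) = nodeAvg a := by
  simp only [nodeAvg]
  rw [Finset.sum_comm]
  congr 1
  refine Finset.sum_congr rfl fun j _ => ?_
  rw [← Finset.sum_smul]
  simp only [fun i => hW.symm i j, hW.row_sum, one_smul]

theorem sqDev_mix_add_le (hW : IsMixingMatrix G W) {p : ℝ} (hp : 0 < p) (hp1 : p ≤ 1)
    (hc : Contracts W d p) (a e : Fin N → Param d) :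
    sqDev (fun i => (∑ j, W i j • a j) + e i) ≤ (1 - p / 2) * sqDev a + 2 / p * sqDev e := by
  have h1 : sqDev (fun i => ∑ j, W i j • a j) ≤ (1 - p) * sqDev a := by
    simp only [sqDev, nodeAvg_mix hW]
    refine (Finset.sum_congr rfl fun i _ => ?_).trans_le (hc a)
    simp only [hW.symm i]
  -- This weight spends half of the contraction on the perturbation: `1 - p ≤ (1 - p / 2)²`, so a
  -- factor `1 - p / 2` remains.
  have h2 := sqDev_add_le (t := 1 - p / 2) (by linarith) (by linarith)
    (fun i => ∑ j, W i j • a j) e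
  have h3 : (1 - (1 - p / 2))⁻¹ = 2 / p := by rw [sub_sub_cancel, inv_div]
  rw [h3] at h2
  refine h2.trans (add_le_add_left ?_ _)
  have h4 : 0 < 1 - p / 2 := by linarith
  rw [inv_mul_le_iff₀ h4]
  have := sqDev_nonneg a
  nlinarith [mul_nonneg (sq_nonneg p) this]

end Mixing

/-- Summing a contraction with additive perturbations. -/
theorem sum_le_of_contraction {s : ℝ} (hs1 : s ≤ 1) {e b : ℕ → ℝ} (he : ∀ r, 0 ≤ e r)
    (h0 : e 0 = 0) (h : ∀ r, e (r + 1) ≤ (1 - s) * e r + b r) (n : ℕ) :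
    s * ∑ r ∈ Finset.range (n + 1), e r ≤ ∑ r ∈ Finset.range n, b r := by
  -- Keeping the last term `e n` on the left makes the induction close; afterwards `s * e n ≤ e n`
  -- lets the sum run up to `n`.
  have key : e n + s * ∑ r ∈ Finset.range n, e r ≤ ∑ r ∈ Finset.range n, b r := by
    induction n with
    | zero => simp [h0]
    | succ n ih =>
      rw [Finset.sum_range_succ, Finset.sum_range_succ]
      linarith [h n]
  rw [Finset.sum_range_succ]
  nlinarith [he n]

/-- Sequences of parameters `x`, momenta `u` and corrections `c` that Momentum Tracking produces
from the stochastic gradients `g`. -/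
structure IsRun {N d : ℕ} (W : Matrix (Fin N) (Fin N) ℝ) (η β : ℝ) (x₀ : Param d)
    (g x u c : ℕ → Fin N → Param d) : Prop where
  x_zero : ∀ i, x 0 i = x₀
  u_zero : ∀ i, u 0 i = (1 - β)⁻¹ • (g 0 i - nodeAvg (g 0))
  c_zero : ∀ i, c 0 i = u 0 i
  u_succ : ∀ r i, u (r + 1) i = β • u r i + g r i
  x_succ : ∀ r i, x (r + 1) i = (∑ j, W i j • x r j) + (-η) • (u (r + 1) i - c r i)
  c_succ : ∀ r i, c (r + 1) i = (∑ j, W i j • (c r j - u (r + 1) j)) + u (r + 1) i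

/-! ### Estimates along a single run -/

namespace IsRun

variable {N d : ℕ} {G : SimpleGraph (Fin N)} {W : Matrix (Fin N) (Fin N) ℝ} {η β : ℝ}
  {x₀ : Param d} {g x u c : ℕ → Fin N → Param d}

theorem nodeAvg_x_zero (hN : 0 < N) (h : IsRun W η β x₀ g x u c) : nodeAvg (x 0) = x₀ := by
  rw [show x 0 = fun _ => x₀ from funext h.x_zero, nodeAvg_const hN]

theorem nodeAvg_u_zero (hN : 0 < N) (h : IsRun W η β x₀ g x u c) : nodeAvg (u 0) = 0 := by
  rw [show u 0 = fun i => _ from funext h.u_zero, nodeAvg_smul, nodeAvg_sub, nodeAvg_const hN,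
    sub_self, smul_zero]

theorem nodeAvg_u_succ (h : IsRun W η β x₀ g x u c) (r : ℕ) :
    nodeAvg (u (r + 1)) = β • nodeAvg (u r) + nodeAvg (g r) := by
  rw [show u (r + 1) = fun i => _ from funext (h.u_succ r), nodeAvg_add, nodeAvg_smul]

theorem nodeAvg_c (hN : 0 < N) (hW : IsMixingMatrix G W) (h : IsRun W η β x₀ g x u c) (r : ℕ) :
    nodeAvg (c r) = 0 := by
  induction r with
  | zero => rw [show c 0 = u 0 from funext h.c_zero, h.nodeAvg_u_zero hN]
  | succ r ih =>
    rw [show c (r + 1) = fun i => _ from funext (h.c_succ r), nodeAvg_add, nodeAvg_mix hW,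
      nodeAvg_sub, ih]
    simp

theorem nodeAvg_x_succ (hN : 0 < N) (hW : IsMixingMatrix G W) (h : IsRun W η β x₀ g x u c)
    (r : ℕ) : nodeAvg (x (r + 1)) = nodeAvg (x r) - η • nodeAvg (u (r + 1)) := by
  rw [show x (r + 1) = fun i => _ from funext (h.x_succ r), nodeAvg_add, nodeAvg_mix hW,
    nodeAvg_smul, nodeAvg_sub, h.nodeAvg_c hN hW, sub_zero, neg_smul, sub_eq_add_neg]

/-- The averaged parameter with the momentum still to come; it moves along the averaged stochastic
gradients. -/
def virtual (η β : ℝ) (x u : ℕ → Fin N → Param d) (r : ℕ) : Param d :=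
  nodeAvg (x r) - (η / (1 - β) * β) • nodeAvg (u r)

theorem virtual_zero (hN : 0 < N) (h : IsRun W η β x₀ g x u c) : virtual η β x u 0 = x₀ := by
  rw [virtual, h.nodeAvg_x_zero hN, h.nodeAvg_u_zero hN, smul_zero, sub_zero]

/-- Writing `a = η / (1 - β)`, the split `η = a - aβ` turns the change in `x̄` into `-a ū_{r+1} + aβ
ū_{r+1}`. The second part cancels against the shift in the definition, and `ū_{r+1} = β ū_r + ḡ_r`
leaves the old shift and `-a ḡ_r`. -/
theorem virtual_succ (hN : 0 < N) (hW : IsMixingMatrix G W) (hβ : β < 1)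
    (h : IsRun W η β x₀ g x u c) (r : ℕ) :
    virtual η β x u (r + 1) = virtual η β x u r - (η / (1 - β)) • nodeAvg (g r) := by
  have h1 : 1 - β ≠ 0 := by linarith
  have h2 : η = η / (1 - β) - η / (1 - β) * β := by field_simp
  rw [virtual, virtual, h.nodeAvg_x_succ hN hW]
  nth_rewrite 1 [h2]
  rw [sub_smul, h.nodeAvg_u_succ]
  module

theorem sum_sq_nodeAvg_u_le (hN : 0 < N) (hβ0 : 0 ≤ β) (hβ : β < 1) (h : IsRun W η β x₀ g x u c)
    (n : ℕ) : ∑ r ∈ Finset.range (n + 1), ‖nodeAvg (u r)‖ ^ 2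
      ≤ ((1 - β) ^ 2)⁻¹ * ∑ r ∈ Finset.range n, ‖nodeAvg (g r)‖ ^ 2 := by
  have h1 : 0 < 1 - β := by linarith
  have := sum_le_of_contraction (s := 1 - β) (by linarith) (e := fun r => ‖nodeAvg (u r)‖ ^ 2)
    (b := fun r => (1 - β)⁻¹ * ‖nodeAvg (g r)‖ ^ 2) (fun _ => sq_nonneg _)
    (by simp [h.nodeAvg_u_zero hN])
    (fun r => by simpa only [h.nodeAvg_u_succ r] using sq_norm_smul_add_le hβ0 hβ _ _) n
  rw [← Finset.mul_sum, ← le_div_iff₀' h1] at this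
  refine this.trans (le_of_eq ?_)
  field_simp

theorem sum_sqDev_x_le (hN : 0 < N) (hW : IsMixingMatrix G W) {p : ℝ} (hp : 0 < p) (hp1 : p ≤ 1)
    (hc : Contracts W d p) (h : IsRun W η β x₀ g x u c) (n : ℕ) :
    ∑ r ∈ Finset.range (n + 1), sqDev (x r)
      ≤ 4 / p ^ 2 * η ^ 2 * ∑ r ∈ Finset.range n, sqDev (fun i => u (r + 1) i - c r i) := by
  have := sum_le_of_contraction (s := p / 2) (by linarith) (e := fun r => sqDev (x r))
    (b := fun r => 2 / p * (η ^ 2 * sqDev (fun i => u (r + 1) i - c r i)))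
    (fun _ => sqDev_nonneg _)
    (by rw [show x 0 = fun _ => x₀ from funext h.x_zero, sqDev_const hN])
    (fun r => by
      rw [show x (r + 1) = fun i => _ from funext (h.x_succ r)]
      refine (sqDev_mix_add_le hW hp hp1 hc _ _).trans (le_of_eq ?_)
      rw [sqDev_smul, neg_sq]) n
  rw [← Finset.mul_sum, ← Finset.mul_sum, ← le_div_iff₀' (by linarith)] at this
  refine this.trans (le_of_eq ?_)
  field_simp
  ring

/-- This is what the initial values are designed for: `(1 - β) u_i` is the deviation of the gradient
from its average, so `β u_i + g_i - u_i` is that average. Since `c 0 = u 0`, all nodes share their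
first direction, and the first momentum increment has no consensus error. -/
theorem first_direction (hβ : β < 1) (h : IsRun W η β x₀ g x u c) (i : Fin N) :
    u 1 i - u 0 i = nodeAvg (g 0) := by
  have h1 : 1 - β ≠ 0 := by linarith
  rw [h.u_succ 0 i, h.u_zero i]
  have : ∀ v w : Param d, β • (1 - β)⁻¹ • (v - w) + v - (1 - β)⁻¹ • (v - w) = w := by
    intro v w
    have h2 : β • (1 - β)⁻¹ • (v - w) + v - (1 - β)⁻¹ • (v - w)
        = v - ((1 - β) * (1 - β)⁻¹) • (v - w) := by module
    rw [h2, mul_inv_cancel₀ h1]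
    module
  exact this _ _

/-- The tracking mechanism: the update of `c` mixes the previous directions, and only the increment
of the momentum enters as a perturbation. -/
theorem direction_succ (h : IsRun W η β x₀ g x u c) (r : ℕ) (i : Fin N) :
    u (r + 2) i - c (r + 1) i
      = (∑ j, W i j • (u (r + 1) j - c r j)) + (u (r + 2) i - u (r + 1) i) := by
  rw [h.c_succ r i]
  have : ∑ j, W i j • (c r j - u (r + 1) j) = - ∑ j, W i j • (u (r + 1) j - c r j) := by
    rw [← Finset.sum_neg_distrib]
    exact Finset.sum_congr rfl fun j _ => by rw [← smul_neg, neg_sub]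
  rw [this]
  abel

theorem sum_sqDev_direction_le (hN : 0 < N) (hW : IsMixingMatrix G W) {p : ℝ} (hp : 0 < p)
    (hp1 : p ≤ 1) (hc : Contracts W d p) (hβ : β < 1) (h : IsRun W η β x₀ g x u c) (n : ℕ) :
    ∑ r ∈ Finset.range (n + 1), sqDev (fun i => u (r + 1) i - c r i)
      ≤ 4 / p ^ 2 * ∑ r ∈ Finset.range n, sqDev (fun i => u (r + 2) i - u (r + 1) i) := by
  have := sum_le_of_contraction (s := p / 2) (by linarith)
    (e := fun r => sqDev (fun i => u (r + 1) i - c r i))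
    (b := fun r => 2 / p * sqDev (fun i => u (r + 2) i - u (r + 1) i))
    (fun _ => sqDev_nonneg _)
    (by
      simp only [h.c_zero, zero_add, h.first_direction hβ]
      exact sqDev_const hN _)
    (fun r => by
      simp only [add_assoc, Nat.reduceAdd]
      rw [show (fun i => u (r + 2) i - c (r + 1) i) = fun i => _ from
        funext (h.direction_succ r)]
      exact sqDev_mix_add_le hW hp hp1 hc _ _) n
  rw [← Finset.mul_sum, ← le_div_iff₀' (by linarith)] at this
  refine this.trans (le_of_eq ?_)
  field_simp
  ring

/-- Momentum increments obey the same recursion as momenta, driven by gradient increments at the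
same node. Here the size of the local gradients, and with it their heterogeneity, drops out. -/
theorem sum_sqDev_u_sub_le (hN : 0 < N) (hβ0 : 0 ≤ β) (hβ : β < 1) (h : IsRun W η β x₀ g x u c)
    (n : ℕ) : ∑ r ∈ Finset.range n, sqDev (fun i => u (r + 2) i - u (r + 1) i)
      ≤ ((1 - β) ^ 2)⁻¹ * ∑ r ∈ Finset.range n, sqDev (fun i => g (r + 1) i - g r i) := by
  have h1 : 0 < 1 - β := by linarith
  have h0 : sqDev (fun i => u 1 i - u 0 i) = 0 := by
    simp only [h.first_direction hβ]
    exact sqDev_const hN _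
  have := sum_le_of_contraction (s := 1 - β) (by linarith)
    (e := fun r => sqDev (fun i => u (r + 1) i - u r i))
    (b := fun r => (1 - β)⁻¹ * sqDev (fun i => g (r + 1) i - g r i)) (fun _ => sqDev_nonneg _)
    h0
    (fun r => by
      have : (fun i => u (r + 1 + 1) i - u (r + 1) i)
          = fun i => β • (u (r + 1) i - u r i) + (g (r + 1) i - g r i) := by
        funext i
        rw [h.u_succ (r + 1) i, h.u_succ r i]
        module
      rw [this]
      exact sqDev_smul_add_le hβ0 hβ _ _) n
  rw [Finset.sum_range_succ', h0, add_zero, ← Finset.mul_sum, ← le_div_iff₀' h1] at this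
  refine this.trans (le_of_eq ?_)
  field_simp

/-- Each node's movement splits into its new deviation, its old deviation and the movement `-η ū` of
the average; the gradient increment splits into the Lipschitz part and two noises. The two threefold
splittings give the `9`. -/
theorem sqDev_grad_sub_le (hN : 0 < N) (hW : IsMixingMatrix G W) (h : IsRun W η β x₀ g x u c)
    {L : ℝ} {q : ℕ → Fin N → Param d}
    (hq : ∀ r i, ‖q (r + 1) i - q r i‖ ≤ L * ‖x (r + 1) i - x r i‖) (r : ℕ) :
    sqDev (fun i => g (r + 1) i - g r i)
      ≤ 9 * L ^ 2 * (sqDev (x (r + 1)) + sqDev (x r) + N * (η ^ 2 * ‖nodeAvg (u (r + 1))‖ ^ 2))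
        + 3 * (∑ i, ‖g (r + 1) i - q (r + 1) i‖ ^ 2 + ∑ i, ‖g r i - q r i‖ ^ 2) := by
  refine (sqDev_le_sum_sq hN _).trans ?_
  have tri : ∀ a b c : Param d, ‖a + b + c‖ ^ 2 ≤ 3 * (‖a‖ ^ 2 + ‖b‖ ^ 2 + ‖c‖ ^ 2) := by
    intro a b c
    have : ‖a + b + c‖ ^ 2 ≤ (‖a‖ + ‖b‖ + ‖c‖) ^ 2 := by gcongr; exact norm_add₃_le
    nlinarith [sq_nonneg (‖a‖ - ‖b‖), sq_nonneg (‖b‖ - ‖c‖), sq_nonneg (‖a‖ - ‖c‖)]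
  have hx : ∀ i, ‖x (r + 1) i - x r i‖ ^ 2 ≤ 3 * (‖x (r + 1) i - nodeAvg (x (r + 1))‖ ^ 2
      + ‖x r i - nodeAvg (x r)‖ ^ 2 + η ^ 2 * ‖nodeAvg (u (r + 1))‖ ^ 2) := by
    intro i
    have h1 := tri (x (r + 1) i - nodeAvg (x (r + 1))) (-(x r i - nodeAvg (x r)))
      (-(η • nodeAvg (u (r + 1))))
    have h2 : x (r + 1) i - nodeAvg (x (r + 1)) + -(x r i - nodeAvg (x r))
        + -(η • nodeAvg (u (r + 1))) = x (r + 1) i - x r i := by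
      rw [h.nodeAvg_x_succ hN hW]; abel
    rwa [h2, norm_neg, norm_neg, norm_smul, mul_pow, Real.norm_eq_abs, sq_abs] at h1
  have hg : ∀ i, ‖g (r + 1) i - g r i‖ ^ 2 ≤ 9 * L ^ 2 * (‖x (r + 1) i - nodeAvg (x (r + 1))‖ ^ 2
      + ‖x r i - nodeAvg (x r)‖ ^ 2 + η ^ 2 * ‖nodeAvg (u (r + 1))‖ ^ 2)
      + 3 * (‖g (r + 1) i - q (r + 1) i‖ ^ 2 + ‖g r i - q r i‖ ^ 2) := by
    intro i
    have h1 := tri (q (r + 1) i - q r i) (g (r + 1) i - q (r + 1) i) (-(g r i - q r i))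
    have h2 : q (r + 1) i - q r i + (g (r + 1) i - q (r + 1) i) + -(g r i - q r i)
        = g (r + 1) i - g r i := by abel
    rw [h2, norm_neg] at h1
    have h3 : ‖q (r + 1) i - q r i‖ ^ 2 ≤ L ^ 2 * ‖x (r + 1) i - x r i‖ ^ 2 := by
      rw [← mul_pow]
      exact pow_le_pow_left₀ (norm_nonneg _) (hq r i) 2
    have h4 := mul_le_mul_of_nonneg_left (hx i) (sq_nonneg L)
    linarith
  refine (Finset.sum_le_sum fun i _ => hg i).trans (le_of_eq ?_)
  simp only [Finset.sum_add_distrib, ← Finset.mul_sum, sqDev, Finset.sum_const, Finset.card_univ,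
    Fintype.card_fin, nsmul_eq_mul]
  ring

/-- The accumulated consensus distance is controlled by the averaged stochastic gradients and by the
noise, without any bound on the heterogeneity. -/
theorem sum_sqDev_x_le_of_stepsize (hN : 0 < N) (hW : IsMixingMatrix G W) {p : ℝ} (hp : 0 < p)
    (hp1 : p ≤ 1) (hc : Contracts W d p) (hβ0 : 0 ≤ β) (hβ : β < 1)
    (h : IsRun W η β x₀ g x u c) {L : ℝ} (hL : 0 ≤ L) {q : ℕ → Fin N → Param d}
    (hq : ∀ r i, ‖q (r + 1) i - q r i‖ ≤ L * ‖x (r + 1) i - x r i‖) {a : ℝ} (ha0 : 0 ≤ a)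
    (ha : a = η / (1 - β)) (haL : 36 * (L * a) ≤ p ^ 2) (n : ℕ) :
    ∑ r ∈ Finset.range (n + 1), sqDev (x r)
      ≤ 32 * (a ^ 2 / p ^ 4) *
        (9 * L ^ 2 * N * (a ^ 2 * ∑ r ∈ Finset.range (n + 1), ‖nodeAvg (g r)‖ ^ 2)
          + 6 * ∑ r ∈ Finset.range (n + 1), ∑ i, ‖g r i - q r i‖ ^ 2) := by
  have h1 : 0 < 1 - β := by linarith
  set SX := ∑ r ∈ Finset.range (n + 1), sqDev (x r) with hSX
  set Sg := ∑ r ∈ Finset.range (n + 1), ‖nodeAvg (g r)‖ ^ 2 with hSg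
  set Sn := ∑ r ∈ Finset.range (n + 1), ∑ i, ‖g r i - q r i‖ ^ 2 with hSn
  set SD := ∑ r ∈ Finset.range n, sqDev (fun i => g (r + 1) i - g r i) with hSD
  -- In this form the factors `(1 - β)²` of `η²` cancel the losses `1 / (1 - β)²` from the momentum
  -- recursions.
  have hη : η = a * (1 - β) := by rw [ha]; field_simp
  have shift : ∀ e : ℕ → ℝ, (∀ r, 0 ≤ e r) →
      ∑ r ∈ Finset.range n, e (r + 1) ≤ ∑ r ∈ Finset.range (n + 1), e r := fun e he => by
    rw [Finset.sum_range_succ']; linarith [he 0]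
  have trunc : ∀ e : ℕ → ℝ, (∀ r, 0 ≤ e r) →
      ∑ r ∈ Finset.range n, e r ≤ ∑ r ∈ Finset.range (n + 1), e r := fun e he => by
    rw [Finset.sum_range_succ]; linarith [he n]
  have hX : SX ≤ 16 * (a ^ 2 / p ^ 4) * SD := by
    have hy := trunc (fun r => sqDev (fun i => u (r + 1) i - c r i)) fun _ => sqDev_nonneg _
    have e1 := h.sum_sqDev_x_le hN hW hp hp1 hc n
    have e2 := h.sum_sqDev_direction_le hN hW hp hp1 hc hβ n
    have e3 := h.sum_sqDev_u_sub_le hN hβ0 hβ n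
    calc SX ≤ 4 / p ^ 2 * η ^ 2 * (4 / p ^ 2 * (((1 - β) ^ 2)⁻¹ * SD)) := by
          refine e1.trans ?_
          gcongr
          refine hy.trans (e2.trans ?_)
          gcongr
      _ = _ := by rw [hη]; field_simp; ring
  have hu : η ^ 2 * ∑ r ∈ Finset.range n, ‖nodeAvg (u (r + 1))‖ ^ 2 ≤ a ^ 2 * Sg := by
    have e1 := shift (fun r => ‖nodeAvg (u r)‖ ^ 2) fun _ => sq_nonneg _
    have e2 := h.sum_sq_nodeAvg_u_le hN hβ0 hβ n
    have e3 := trunc (fun r => ‖nodeAvg (g r)‖ ^ 2) fun _ => sq_nonneg _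
    calc _ ≤ η ^ 2 * (((1 - β) ^ 2)⁻¹ * Sg) := by
          gcongr
          refine e1.trans (e2.trans ?_)
          gcongr
      _ = _ := by rw [hη]; field_simp
  have hD : SD ≤ 18 * L ^ 2 * SX + 9 * L ^ 2 * N * (a ^ 2 * Sg) + 6 * Sn := by
    have e0 := Finset.sum_le_sum fun r (_ : r ∈ Finset.range n) =>
      h.sqDev_grad_sub_le hN hW hq r
    simp only [Finset.sum_add_distrib, ← Finset.mul_sum] at e0
    have e1 := shift (fun r => sqDev (x r)) fun _ => sqDev_nonneg _
    have e2 := trunc (fun r => sqDev (x r)) fun _ => sqDev_nonneg _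
    have hnn : ∀ r, 0 ≤ ∑ i, ‖g r i - q r i‖ ^ 2 := fun r =>
      Finset.sum_nonneg fun _ _ => sq_nonneg _
    have e3 := shift (fun r => ∑ i, ‖g r i - q r i‖ ^ 2) hnn
    have e4 := trunc (fun r => ∑ i, ‖g r i - q r i‖ ^ 2) hnn
    calc SD ≤ _ := e0
      _ ≤ 9 * L ^ 2 * (SX + SX + N * (a ^ 2 * Sg)) + 3 * (Sn + Sn) := by gcongr
      _ = _ := by ring
  have hSX0 : 0 ≤ SX := Finset.sum_nonneg fun _ _ => sqDev_nonneg _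
  -- The coefficient is `288 (L a)² / p⁴ ≤ 288 / 1296`. Moving half of `SX` to the left then doubles
  -- `16` to `32`.
  have hsmall : 16 * (a ^ 2 / p ^ 4) * (18 * L ^ 2) ≤ 1 / 2 := by
    have e1 : (36 * (L * a)) ^ 2 ≤ (p ^ 2) ^ 2 := pow_le_pow_left₀ (by positivity) haL 2
    rw [show 16 * (a ^ 2 / p ^ 4) * (18 * L ^ 2) = 288 * (L * a) ^ 2 / p ^ 4 by ring,
      div_le_iff₀ (by positivity)]
    nlinarith [sq_nonneg (L * a)]
  have hk : 0 ≤ 16 * (a ^ 2 / p ^ 4) := by positivity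
  have e1 := mul_le_mul_of_nonneg_left hD hk
  have e2 := mul_le_mul_of_nonneg_right hsmall hSX0
  nlinarith

theorem sum_sq_virtual_sub_le (hN : 0 < N) (hβ0 : 0 ≤ β) (hβ : β < 1)
    (h : IsRun W η β x₀ g x u c) (n : ℕ) :
    ∑ r ∈ Finset.range (n + 1), ‖virtual η β x u r - nodeAvg (x r)‖ ^ 2
      ≤ (η / (1 - β)) ^ 2 * β ^ 2 / (1 - β) ^ 2
        * ∑ r ∈ Finset.range (n + 1), ‖nodeAvg (g r)‖ ^ 2 := by
  have h1 : ∀ r, ‖virtual η β x u r - nodeAvg (x r)‖ ^ 2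
      = ((η / (1 - β)) ^ 2 * β ^ 2) * ‖nodeAvg (u r)‖ ^ 2 := fun r => by
    rw [virtual, sub_sub_cancel_left, norm_neg, norm_smul, mul_pow, Real.norm_eq_abs, sq_abs,
      mul_pow]
  simp only [h1, ← Finset.mul_sum]
  rw [div_eq_mul_inv _ ((1 - β) ^ 2), mul_assoc _ ((1 - β) ^ 2)⁻¹]
  refine mul_le_mul_of_nonneg_left ?_ (by positivity)
  refine (h.sum_sq_nodeAvg_u_le hN hβ0 hβ n).trans ?_
  refine mul_le_mul_of_nonneg_left ?_ (by positivity)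
  rw [Finset.sum_range_succ]
  exact le_add_of_nonneg_right (sq_nonneg _)

end IsRun

end

end MomentumTracking

namespace MomentumTracking

noncomputable section

/-! ### Square-integrable random vectors -/

section SquareIntegrable

variable {d : ℕ} {Ω : Type*} [MeasurableSpace Ω] {P : Measure Ω}

theorem integrable_inner_of_memLp {f g : Ω → Param d} (hf : MemLp f 2 P) (hg : MemLp g 2 P) :
    Integrable (fun ω => inner ℝ (f ω) (g ω)) P := by
  refine Integrable.mono' (g := fun ω => ‖f ω‖ ^ 2 + ‖g ω‖ ^ 2)
    ((hf.integrable_norm_pow two_ne_zero).add (hg.integrable_norm_pow two_ne_zero))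
    (hf.1.inner hg.1) (ae_of_all _ fun ω => ?_)
  refine (norm_inner_le_norm _ _).trans ?_
  nlinarith [sq_nonneg (‖f ω‖ - ‖g ω‖), sq_nonneg (‖f ω‖), sq_nonneg (‖g ω‖)]

theorem memLp_comp_of_lipschitz [IsFiniteMeasure P] {T : Param d → Param d} {L : ℝ}
    (hT : ∀ x y, ‖T x - T y‖ ≤ L * ‖x - y‖) (hc : Continuous T) {f : Ω → Param d}
    (hf : MemLp f 2 P) : MemLp (fun ω => T (f ω)) 2 P := by
  have hb : MemLp (fun ω => L * ‖f ω‖) 2 P := hf.norm.const_mul L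
  have ha : MemLp (fun _ : Ω => ‖T 0‖) 2 P := memLp_const ‖T 0‖
  have hab : MemLp (fun ω => ‖T 0‖ + L * ‖f ω‖) 2 P := ha.add hb
  refine MemLp.mono' hab (hc.comp_aestronglyMeasurable hf.1)
    (ae_of_all _ fun ω => ?_)
  have h1 := hT (f ω) 0
  simp only [sub_zero] at h1
  have h2 := norm_add_le (T 0) (T (f ω) - T 0)
  rw [add_sub_cancel] at h2
  linarith

theorem memLp_nodeAvg {N : ℕ} {f : Fin N → Ω → Param d} (hf : ∀ i, MemLp (f i) 2 P) :
    MemLp (fun ω => nodeAvg (fun i => f i ω)) 2 P :=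
  (memLp_finsetSum Finset.univ fun i _ => hf i).const_smul ((N : ℝ)⁻¹)

end SquareIntegrable

/-! ### Fresh samples evaluated at random points -/

section Independence

variable {Ω α T : Type*} [MeasurableSpace Ω] [MeasurableSpace α] [MeasurableSpace T]
  {P : Measure Ω} [IsProbabilityMeasure P] {μ : Measure T}

theorem map_prodMk_eq_prod {Z : Ω → α} {s : Ω → T} (hZ : Measurable Z) (hs : Measurable s)
    (hi : IndepFun Z s P) (hμ : P.map s = μ) :
    P.map (fun ω => (Z ω, s ω)) = (P.map Z).prod μ := by
  rw [(indepFun_iff_map_prod_eq_prod_map_map hZ.aemeasurable hs.aemeasurable).1 hi, hμ]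

variable {d : ℕ} [IsProbabilityMeasure μ]

/-- The components of `Z` are the test vector and the point at which the noise `h` is evaluated.
Under the product law, integrating over the fresh sample first gives zero. -/
theorem integral_inner_eq_zero_of_indepFun {Z : Ω → Param d × Param d} {s : Ω → T}
    (hZ : Measurable Z) (hs : Measurable s) (hi : IndepFun Z s P) (hμ : P.map s = μ)
    {h : Param d × T → Param d} (hh : Measurable h) (hhi : ∀ x, Integrable (fun t => h (x, t)) μ)
    (h0 : ∀ x, ∫ t, h (x, t) ∂μ = 0)
    (hint : Integrable (fun ω => inner ℝ (Z ω).1 (h ((Z ω).2, s ω))) P) :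
    ∫ ω, inner ℝ (Z ω).1 (h ((Z ω).2, s ω)) ∂P = 0 := by
  have hmap := map_prodMk_eq_prod hZ hs hi hμ
  set φ : (Param d × Param d) × T → ℝ := fun z => inner ℝ z.1.1 (h (z.1.2, z.2)) with hφ
  have hφm : Measurable φ := by
    have : Measurable fun z : (Param d × Param d) × T => h (z.1.2, z.2) :=
      hh.comp (by fun_prop)
    exact Measurable.inner (by fun_prop) this
  have hm : AEMeasurable (fun ω => (Z ω, s ω)) P := (hZ.prodMk hs).aemeasurable
  have h1 : Integrable φ ((P.map Z).prod μ) := by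
    rw [← hmap, integrable_map_measure hφm.aestronglyMeasurable hm]
    exact hint
  have h2 : ∫ ω, inner ℝ (Z ω).1 (h ((Z ω).2, s ω)) ∂P = ∫ z, φ z ∂((P.map Z).prod μ) := by
    rw [← hmap, integral_map hm hφm.aestronglyMeasurable]
  have : IsProbabilityMeasure (P.map Z) := Measure.isProbabilityMeasure_map hZ.aemeasurable
  rw [h2, integral_prod _ h1]
  have h3 : ∀ z : Param d × Param d, ∫ t, φ (z, t) ∂μ = 0 := fun z => by
    have := integral_inner (hhi z.2) z.1 (𝕜 := ℝ)
    rw [h0, inner_zero_right] at this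
    exact this
  simp [h3]

/-- Fubini again; the bound is uniform in the point, so no moment of `X` is required. This allows
the noise to be controlled before the iterates are known to be square integrable. -/
theorem integral_sq_norm_le_of_indepFun {X : Ω → Param d} {s : Ω → T}
    (hX : Measurable X) (hs : Measurable s) (hi : IndepFun X s P) (hμ : P.map s = μ)
    {h : Param d × T → Param d} (hh : Measurable h) {v : ℝ}
    (hv : ∀ x, Integrable (fun t => ‖h (x, t)‖ ^ 2) μ ∧ ∫ t, ‖h (x, t)‖ ^ 2 ∂μ ≤ v) :
    Integrable (fun ω => ‖h (X ω, s ω)‖ ^ 2) P ∧ ∫ ω, ‖h (X ω, s ω)‖ ^ 2 ∂P ≤ v := by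
  have hmap := map_prodMk_eq_prod hX hs hi hμ
  have hφm : Measurable fun z => ‖h z‖ ^ 2 := hh.norm.pow_const 2
  have hm : AEMeasurable (fun ω => (X ω, s ω)) P := (hX.prodMk hs).aemeasurable
  have : IsProbabilityMeasure (P.map X) := Measure.isProbabilityMeasure_map hX.aemeasurable
  have hmeas : AEStronglyMeasurable (fun x => ∫ t, ‖h (x, t)‖ ^ 2 ∂μ) (P.map X) :=
    (hφm.stronglyMeasurable.integral_prod_right').aestronglyMeasurable
  have hbd : Integrable (fun x => ∫ t, ‖h (x, t)‖ ^ 2 ∂μ) (P.map X) :=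
    Integrable.mono' (integrable_const v) hmeas (ae_of_all _ fun x => by
      rw [Real.norm_of_nonneg (integral_nonneg fun _ => sq_nonneg _)]
      exact (hv x).2)
  have h1 : Integrable (fun z => ‖h z‖ ^ 2) ((P.map X).prod μ) := by
    rw [integrable_prod_iff hφm.aestronglyMeasurable]
    refine ⟨ae_of_all _ fun x => (hv x).1, ?_⟩
    simpa only [Real.norm_of_nonneg (sq_nonneg _)] using hbd
  have h2 : ∫ ω, ‖h (X ω, s ω)‖ ^ 2 ∂P = ∫ z, ‖h z‖ ^ 2 ∂((P.map X).prod μ) := by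
    rw [← hmap, integral_map hm hφm.aestronglyMeasurable]
  constructor
  · rw [← hmap, integrable_map_measure hφm.aestronglyMeasurable hm] at h1
    exact h1
  · rw [h2, integral_prod _ h1]
    calc _ ≤ ∫ _x, v ∂(P.map X) := integral_mono hbd (integrable_const _) fun x => (hv x).2
      _ = v := by simp

end Independence

/-! ### Dependence of the iterates on the samples -/

section Sampling

variable {N d : ℕ} {S : Fin N → Type*}

theorem isRun_iterate {G : SimpleGraph (Fin N)} {W : Matrix (Fin N) (Fin N) ℝ}
    (hW : IsMixingMatrix G W) (F : ∀ i, Param d → S i → ℝ) (η β : ℝ) (x₀ : Param d)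
    (s : ∀ i, ℕ → S i) :
    IsRun W η β x₀ (fun r i => stochGrad F i ((iterate F G W η β x₀ s r).x i) (s i r))
      (fun r => (iterate F G W η β x₀ s r).x) (fun r => (iterate F G W η β x₀ s r).u)
      (fun r => (iterate F G W η β x₀ s r).c) where
  x_zero _ := rfl
  u_zero _ := rfl
  c_zero _ := rfl
  u_succ _ _ := rfl
  x_succ r i := by
    simp only [iterate, step, gossip_eq_sum hW, neg_smul, ← sub_eq_add_neg]
  c_succ r i := by
    simp only [iterate, step, gossip_eq_sum hW]

variable [∀ i, MeasurableSpace (S i)] {D : ∀ i, Measure (S i)} {F : ∀ i, Param d → S i → ℝ}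
  {G : SimpleGraph (Fin N)} {W : Matrix (Fin N) (Fin N) ℝ} {η β : ℝ} {x₀ : Param d}

theorem measurable_stochGrad (hF : IsRegular D F) (i : Fin N) :
    Measurable fun z : Param d × S i => stochGrad F i z.1 z.2 :=
  measurable_gradient (hF.differentiable i) (hF.measurable i)

theorem measurable_nodeAvg {Ω : Type*} {m : MeasurableSpace Ω} {f : Fin N → Ω → Param d}
    (hf : ∀ i, Measurable (f i)) : Measurable fun ω => nodeAvg (fun i => f i ω) := by
  have h : Measurable fun ω => ∑ i, f i ω := Finset.measurable_fun_sum _ fun i _ => hf i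
  unfold nodeAvg
  fun_prop

theorem measurable_mix {Ω : Type*} {m : MeasurableSpace Ω} {f : Fin N → Ω → Param d}
    (hf : ∀ i, Measurable (f i)) (w : Fin N → ℝ) : Measurable fun ω => ∑ i, w i • f i ω :=
  Finset.measurable_fun_sum _ fun i _ => by
    have := hf i
    fun_prop

/-- The σ-algebra is arbitrary, so that the lemma also applies to the one generated by all samples
but one. Round `0` is required separately because its samples already enter the initial momenta. -/
theorem measurable_iterate (hF : IsRegular D F) (hW : IsMixingMatrix G W) {Ω : Type*}
    {m : MeasurableSpace Ω} {ξ : ∀ i, ℕ → Ω → S i} (h0 : ∀ i, Measurable (ξ i 0)) (r : ℕ)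
    (hr : ∀ i, ∀ k < r, Measurable (ξ i k)) (i : Fin N) :
    Measurable (fun ω => (iterate F G W η β x₀ (fun i k => ξ i k ω) r).x i) ∧
    Measurable (fun ω => (iterate F G W η β x₀ (fun i k => ξ i k ω) r).u i) ∧
    Measurable (fun ω => (iterate F G W η β x₀ (fun i k => ξ i k ω) r).c i) := by
  induction r generalizing i with
  | zero =>
    have hg : ∀ j, Measurable fun ω => stochGrad F j x₀ (ξ j 0 ω) := fun j =>
      (measurable_stochGrad hF j).comp (measurable_const.prodMk (h0 j))
    have hi : Measurable fun ω => initValue F β x₀ (fun i => ξ i 0 ω) i := by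
      have h1 := hg i
      have h2 := measurable_nodeAvg hg
      unfold initValue
      fun_prop
    exact ⟨measurable_const, hi, hi⟩
  | succ r ih =>
    have ih := ih fun j k hk => hr j k (hk.trans r.lt_succ_self)
    have hu : ∀ j, Measurable fun ω => nextU F β (fun i => ξ i r ω)
        (iterate F G W η β x₀ (fun i k => ξ i k ω) r) j := fun j => by
      have h1 := (ih j).2.1
      have h2 : Measurable fun ω => stochGrad F j
          ((iterate F G W η β x₀ (fun i k => ξ i k ω) r).x j) (ξ j r ω) :=
        (measurable_stochGrad hF j).comp ((ih j).1.prodMk (hr j r r.lt_succ_self))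
      unfold nextU
      fun_prop
    have hi := hu i
    have hx := measurable_mix (fun j => (ih j).1) (W i)
    have hc := measurable_mix (fun j => (ih j).2.2.sub (hu j)) (W i)
    have hci := (ih i).2.2
    simp only [iterate, step, gossip_eq_sum hW]
    simp only [Pi.sub_apply] at hc
    refine ⟨?_, hi, ?_⟩ <;> fun_prop

/-- The parameters and the averaged momentum at the start of round `r` depend on the samples of the
earlier rounds only. -/
theorem measurable_x_and_nodeAvg_u (hN : 0 < N) (hF : IsRegular D F) (hW : IsMixingMatrix G W)
    {Ω : Type*} {m : MeasurableSpace Ω} {ξ : ∀ i, ℕ → Ω → S i} (r : ℕ)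
    (hr : ∀ i, ∀ k < r, Measurable (ξ i k)) :
    (∀ i, Measurable fun ω => (iterate F G W η β x₀ (fun i k => ξ i k ω) r).x i) ∧
    Measurable (fun ω => nodeAvg (iterate F G W η β x₀ (fun i k => ξ i k ω) r).u) := by
  -- At the start the individual momenta depend on the samples of round `0`, which are used again in
  -- that round; their average, however, is identically zero.
  rcases Nat.eq_zero_or_pos r with rfl | h0
  · refine ⟨fun i => measurable_const, ?_⟩
    have : (fun ω => nodeAvg (iterate F G W η β x₀ (fun i k => ξ i k ω) 0).u) = fun _ => 0 :=
      funext fun ω => (isRun_iterate hW F η β x₀ fun i k => ξ i k ω).nodeAvg_u_zero hN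
    rw [this]
    exact measurable_const
  · have h := measurable_iterate (η := η) (β := β) (x₀ := x₀) hF hW (fun i => hr i 0 h0) r hr
    exact ⟨fun i => (h i).1, measurable_nodeAvg fun j => (h j).2.1⟩

/-- The information in all samples except that of node `i` in round `r`. -/
abbrev otherSamples {Ω : Type*} (ξ : ∀ i, ℕ → Ω → S i) (i : Fin N) (r : ℕ) : MeasurableSpace Ω :=
  ⨆ k ∈ ({(i, r)}ᶜ : Set (Fin N × ℕ)), MeasurableSpace.comap (ξ k.1 k.2) inferInstance

theorem measurable_otherSamples {Ω : Type*} (ξ : ∀ i, ℕ → Ω → S i) {i j : Fin N} {r k : ℕ}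
    (h : (j, k) ≠ (i, r)) : Measurable[otherSamples ξ i r] (ξ j k) := by
  refine Measurable.mono (comap_measurable (ξ j k)) ?_ le_rfl
  exact le_iSup₂_of_le (f := fun (k : Fin N × ℕ) (_ : k ∈ ({(i, r)}ᶜ : Set (Fin N × ℕ))) =>
    MeasurableSpace.comap (ξ k.1 k.2) inferInstance) (j, k) h le_rfl

theorem otherSamples_le {Ω : Type*} [mΩ : MeasurableSpace Ω] {P : Measure Ω}
    {ξ : ∀ i, ℕ → Ω → S i} (hξ : IsSampling P D ξ) (i : Fin N) (r : ℕ) :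
    otherSamples ξ i r ≤ mΩ :=
  iSup₂_le fun k _ => (hξ.measurable k.1 k.2).comap_le

theorem indepFun_of_measurable_otherSamples {Ω : Type*} [mΩ : MeasurableSpace Ω] {P : Measure Ω}
    {ξ : ∀ i, ℕ → Ω → S i} (hξ : IsSampling P D ξ) (i : Fin N) (r : ℕ) {α : Type*}
    [mα : MeasurableSpace α] {Z : Ω → α} (hZ : Measurable[otherSamples ξ i r] Z) :
    IndepFun Z (ξ i r) P := by
  have h := indep_iSup_of_disjoint (fun k : Fin N × ℕ => (hξ.measurable k.1 k.2).comap_le)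
    hξ.indep.iIndep (S := {(i, r)}ᶜ) (T := {(i, r)}) disjoint_compl_left
  rw [IndepFun_iff_Indep]
  refine indep_of_indep_of_le_left ?_ hZ.comap_le
  simp only [Set.mem_singleton_iff, iSup_iSup_eq_left] at h
  exact h

end Sampling

end

end MomentumTracking

/-! ### Moments of the iterates and of the noise -/

namespace MomentumTracking

noncomputable section

variable {N d : ℕ} {S : Fin N → Type*} [∀ i, MeasurableSpace (S i)]

/-- The standing assumptions on the network, the losses and the samples. -/
structure IsModel (G : SimpleGraph (Fin N)) (W : Matrix (Fin N) (Fin N) ℝ) (p : ℝ)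
    (D : ∀ i, Measure (S i)) (F : ∀ i, Param d → S i → ℝ) (L σ : ℝ) {Ω : Type*}
    [MeasurableSpace Ω] (P : Measure Ω) (ξ : ∀ i, ℕ → Ω → S i) : Prop where
  pos : 0 < N
  mixing : IsMixingMatrix G W
  p_pos : 0 < p
  p_le_one : p ≤ 1
  contracts : Contracts W d p
  regular : IsRegular D F
  L_pos : 0 < L
  smooth : IsSmooth D F L
  variance : HasVarianceBound D F σ
  sampling : IsSampling P D ξ

section Smoothness

variable {D : ∀ i, Measure (S i)} {F : ∀ i, Param d → S i → ℝ} {L : ℝ}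

theorem continuous_of_norm_sub_le {T : Param d → Param d}
    (hT : ∀ x y, ‖T x - T y‖ ≤ L * ‖x - y‖) (hL : 0 ≤ L) : Continuous T :=
  (LipschitzWith.of_dist_le_mul (K := ⟨L, hL⟩) fun x y => by
    rw [dist_eq_norm, dist_eq_norm]; exact hT x y).continuous

theorem continuous_localGrad (hs : IsSmooth D F L) (hL : 0 ≤ L) (i : Fin N) :
    Continuous (localGrad D F i) :=
  continuous_of_norm_sub_le (hs i) hL

/-- The average of the local gradients is compared with the gradient at a common point. -/
theorem mul_sq_norm_globalGrad_sub_le (hN : 0 < N) (hs : IsSmooth D F L) (y : Param d)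
    (x : Fin N → Param d) :
    N * ‖globalGrad D F y - nodeAvg (fun i => localGrad D F i (x i))‖ ^ 2
      ≤ L ^ 2 * ∑ i, ‖x i - y‖ ^ 2 := by
  rw [globalGrad, ← nodeAvg_sub, Finset.mul_sum]
  refine (mul_sq_norm_nodeAvg_le hN _).trans (Finset.sum_le_sum fun i _ => ?_)
  rw [← mul_pow, norm_sub_rev (x i)]
  exact pow_le_pow_left₀ (norm_nonneg _) (hs i y (x i)) 2

theorem norm_globalGrad_sub_le (hN : 0 < N) (hs : IsSmooth D F L) (hL : 0 ≤ L) (x y : Param d) :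
    ‖globalGrad D F x - globalGrad D F y‖ ≤ L * ‖x - y‖ := by
  have hN' : (0 : ℝ) < N := by exact_mod_cast hN
  -- With all nodes placed at the same point, the average of the local gradients is the global
  -- gradient there.
  have h := mul_sq_norm_globalGrad_sub_le hN hs x (fun _ => y)
  simp only [Finset.sum_const, Finset.card_univ, Fintype.card_fin, nsmul_eq_mul] at h
  rw [norm_sub_rev y, mul_left_comm, mul_le_mul_iff_right₀ hN', ← mul_pow] at h
  exact (pow_le_pow_iff_left₀ (norm_nonneg _) (by positivity) two_ne_zero).1 h

end Smoothness

variable {G : SimpleGraph (Fin N)} {W : Matrix (Fin N) (Fin N) ℝ} {p : ℝ}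
  {D : ∀ i, Measure (S i)} {F : ∀ i, Param d → S i → ℝ} {L σ : ℝ} {Ω : Type*}
  {ξ : ∀ i, ℕ → Ω → S i} {η β : ℝ} {x₀ : Param d}

/-- The random state of the algorithm at the start of round `r`. -/
def stateAt (F : ∀ i, Param d → S i → ℝ) (G : SimpleGraph (Fin N))
    (W : Matrix (Fin N) (Fin N) ℝ) (η β : ℝ) (x₀ : Param d) (ξ : ∀ i, ℕ → Ω → S i) (r : ℕ)
    (ω : Ω) : State N d :=
  iterate F G W η β x₀ (fun i k => ξ i k ω) r

/-- The stochastic gradient of node `i` in round `r`. -/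
def stochGradAt (F : ∀ i, Param d → S i → ℝ) (G : SimpleGraph (Fin N))
    (W : Matrix (Fin N) (Fin N) ℝ) (η β : ℝ) (x₀ : Param d) (ξ : ∀ i, ℕ → Ω → S i) (r : ℕ)
    (ω : Ω) (i : Fin N) : Param d :=
  stochGrad F i ((stateAt F G W η β x₀ ξ r ω).x i) (ξ i r ω)

/-- The full local gradient of node `i` in round `r`. -/
def localGradAt (D : ∀ i, Measure (S i)) (F : ∀ i, Param d → S i → ℝ) (G : SimpleGraph (Fin N))
    (W : Matrix (Fin N) (Fin N) ℝ) (η β : ℝ) (x₀ : Param d) (ξ : ∀ i, ℕ → Ω → S i) (r : ℕ)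
    (ω : Ω) (i : Fin N) : Param d :=
  localGrad D F i ((stateAt F G W η β x₀ ξ r ω).x i)

/-- The noise in the stochastic gradient of node `i` in round `r`. -/
def noiseAt (D : ∀ i, Measure (S i)) (F : ∀ i, Param d → S i → ℝ) (G : SimpleGraph (Fin N))
    (W : Matrix (Fin N) (Fin N) ℝ) (η β : ℝ) (x₀ : Param d) (ξ : ∀ i, ℕ → Ω → S i) (r : ℕ)
    (ω : Ω) (i : Fin N) : Param d :=
  stochGradAt F G W η β x₀ ξ r ω i - localGradAt D F G W η β x₀ ξ r ω i

/-- The virtual iterate in round `r`. -/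
def virtualAt (F : ∀ i, Param d → S i → ℝ) (G : SimpleGraph (Fin N))
    (W : Matrix (Fin N) (Fin N) ℝ) (η β : ℝ) (x₀ : Param d) (ξ : ∀ i, ℕ → Ω → S i) (r : ℕ)
    (ω : Ω) : Param d :=
  IsRun.virtual η β (fun r => (stateAt F G W η β x₀ ξ r ω).x)
    (fun r => (stateAt F G W η β x₀ ξ r ω).u) r

theorem nodeAvg_stochGradAt_eq (r : ℕ) (ω : Ω) :
    nodeAvg (stochGradAt F G W η β x₀ ξ r ω)
      = nodeAvg (localGradAt D F G W η β x₀ ξ r ω) + nodeAvg (noiseAt D F G W η β x₀ ξ r ω) := by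
  rw [← nodeAvg_add]
  simp [noiseAt]

theorem measurable_otherSamples_of_lt {i : Fin N} {r : ℕ} (j : Fin N) (k : ℕ) (hk : k < r) :
    Measurable[otherSamples ξ i r] (ξ j k) :=
  measurable_otherSamples ξ fun h => hk.ne (Prod.ext_iff.1 h).2

section Measurability

variable {m : MeasurableSpace Ω}

theorem measurable_stateAt_x (hN : 0 < N) (hW : IsMixingMatrix G W) (hF : IsRegular D F) (r : ℕ)
    (hr : ∀ i, ∀ k < r, Measurable (ξ i k)) (i : Fin N) :
    Measurable fun ω => (stateAt F G W η β x₀ ξ r ω).x i :=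
  (measurable_x_and_nodeAvg_u hN hF hW r hr).1 i

theorem measurable_localGradAt (hN : 0 < N) (hW : IsMixingMatrix G W) (hF : IsRegular D F)
    (hs : IsSmooth D F L) (hL : 0 ≤ L) (r : ℕ) (hr : ∀ i, ∀ k < r, Measurable (ξ i k))
    (i : Fin N) : Measurable fun ω => localGradAt D F G W η β x₀ ξ r ω i :=
  (continuous_localGrad hs hL i).measurable.comp (measurable_stateAt_x hN hW hF r hr i)

theorem measurable_noiseAt (hN : 0 < N) (hW : IsMixingMatrix G W) (hF : IsRegular D F)
    (hs : IsSmooth D F L) (hL : 0 ≤ L) (r : ℕ) (hr : ∀ i, ∀ k < r, Measurable (ξ i k))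
    (i : Fin N) (hi : Measurable (ξ i r)) :
    Measurable fun ω => noiseAt D F G W η β x₀ ξ r ω i := by
  have h1 : Measurable fun ω => stochGradAt F G W η β x₀ ξ r ω i :=
    (measurable_stochGrad hF i).comp ((measurable_stateAt_x hN hW hF r hr i).prodMk hi)
  exact h1.sub (measurable_localGradAt hN hW hF hs hL r hr i)

theorem measurable_virtualAt (hN : 0 < N) (hW : IsMixingMatrix G W) (hF : IsRegular D F) (r : ℕ)
    (hr : ∀ i, ∀ k < r, Measurable (ξ i k)) : Measurable (virtualAt F G W η β x₀ ξ r) := by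
  have h := measurable_x_and_nodeAvg_u (η := η) (β := β) (x₀ := x₀) hN hF hW r hr
  exact (measurable_nodeAvg h.1).sub (h.2.const_smul (η / (1 - β) * β))

end Measurability

variable [mΩ : MeasurableSpace Ω] {P : Measure Ω}

namespace IsModel

theorem isRun (hM : IsModel G W p D F L σ P ξ) (η β : ℝ) (x₀ : Param d) (ω : Ω) :
    IsRun W η β x₀ (fun r => stochGradAt F G W η β x₀ ξ r ω)
      (fun r => (stateAt F G W η β x₀ ξ r ω).x) (fun r => (stateAt F G W η β x₀ ξ r ω).u)
      (fun r => (stateAt F G W η β x₀ ξ r ω).c) :=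
  isRun_iterate hM.mixing F η β x₀ fun i k => ξ i k ω

variable [IsProbabilityMeasure P]

theorem memLp_globalGrad (hM : IsModel G W p D F L σ P ξ) {f : Ω → Param d} (hf : MemLp f 2 P) :
    MemLp (fun ω => globalGrad D F (f ω)) 2 P :=
  memLp_comp_of_lipschitz (norm_globalGrad_sub_le hM.pos hM.smooth hM.L_pos.le)
    (continuous_of_norm_sub_le (norm_globalGrad_sub_le hM.pos hM.smooth hM.L_pos.le) hM.L_pos.le)
    hf

theorem memLp_localGradAt (hM : IsModel G W p D F L σ P ξ) {r : ℕ} {i : Fin N}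
    (hx : MemLp (fun ω => (stateAt F G W η β x₀ ξ r ω).x i) 2 P) :
    MemLp (fun ω => localGradAt D F G W η β x₀ ξ r ω i) 2 P :=
  memLp_comp_of_lipschitz (hM.smooth i) (continuous_localGrad hM.smooth hM.L_pos.le i) hx

variable [∀ i, IsProbabilityMeasure (D i)]

/-! ### Square integrability -/

theorem noise_moments (hM : IsModel G W p D F L σ P ξ) (r : ℕ) (i : Fin N) :
    Integrable (fun ω => ‖noiseAt D F G W η β x₀ ξ r ω i‖ ^ 2) P ∧
      ∫ ω, ‖noiseAt D F G W η β x₀ ξ r ω i‖ ^ 2 ∂P ≤ σ ^ 2 := by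
  have hm : Measurable fun z : Param d × S i => stochGrad F i z.1 z.2 - localGrad D F i z.1 :=
    (measurable_stochGrad hM.regular i).sub
      ((continuous_localGrad hM.smooth hM.L_pos.le i).measurable.comp measurable_fst)
  exact integral_sq_norm_le_of_indepFun
    (measurable_stateAt_x hM.pos hM.mixing hM.regular r (fun j k _ => hM.sampling.measurable j k) i)
    (hM.sampling.measurable i r)
    (indepFun_of_measurable_otherSamples hM.sampling i r
      (measurable_stateAt_x hM.pos hM.mixing hM.regular r measurable_otherSamples_of_lt i))
    (hM.sampling.law i r) hm (hM.variance i)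

theorem memLp_noiseAt (hM : IsModel G W p D F L σ P ξ) (r : ℕ) (i : Fin N) :
    MemLp (fun ω => noiseAt D F G W η β x₀ ξ r ω i) 2 P := by
  have hm := measurable_noiseAt (η := η) (β := β) (x₀ := x₀) hM.pos hM.mixing hM.regular
    hM.smooth hM.L_pos.le r (fun j k _ => hM.sampling.measurable j k) i (hM.sampling.measurable i r)
  exact (memLp_two_iff_integrable_sq_norm hm.aestronglyMeasurable).2 (hM.noise_moments r i).1

/-- Only the noise has an assumed second moment; the remaining part is a Lipschitz image of the
parameter. -/
theorem memLp_stochGradAt (hM : IsModel G W p D F L σ P ξ) {r : ℕ} {i : Fin N}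
    (hx : MemLp (fun ω => (stateAt F G W η β x₀ ξ r ω).x i) 2 P) :
    MemLp (fun ω => stochGradAt F G W η β x₀ ξ r ω i) 2 P := by
  have h := (hM.memLp_noiseAt (η := η) (β := β) (x₀ := x₀) r i).add (hM.memLp_localGradAt hx)
  refine h.congr_norm ?_ (ae_of_all _ fun ω => by simp [noiseAt])
  have : (fun ω => stochGradAt F G W η β x₀ ξ r ω i)
      = (fun ω => noiseAt D F G W η β x₀ ξ r ω i)
        + fun ω => localGradAt D F G W η β x₀ ξ r ω i := by
    funext ω; simp [noiseAt]
  rw [this]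
  exact h.1

theorem memLp_state (hM : IsModel G W p D F L σ P ξ) (r : ℕ) (i : Fin N) :
    MemLp (fun ω => (stateAt F G W η β x₀ ξ r ω).x i) 2 P ∧
    MemLp (fun ω => (stateAt F G W η β x₀ ξ r ω).u i) 2 P ∧
    MemLp (fun ω => (stateAt F G W η β x₀ ξ r ω).c i) 2 P := by
  induction r generalizing i with
  | zero =>
    have hx : ∀ j, MemLp (fun ω => (stateAt F G W η β x₀ ξ 0 ω).x j) 2 P := fun j =>
      memLp_const x₀
    have hg := fun j => hM.memLp_stochGradAt (hx j)
    have hu : ∀ j, MemLp (fun ω => (stateAt F G W η β x₀ ξ 0 ω).u j) 2 P := fun j =>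
      ((hg j).sub (memLp_nodeAvg hg)).const_smul (1 - β)⁻¹
    exact ⟨hx i, hu i, hu i⟩
  | succ r ih =>
    have hu : ∀ j, MemLp (fun ω => (stateAt F G W η β x₀ ξ (r + 1) ω).u j) 2 P := fun j =>
      ((ih j).2.1.const_smul β).add (hM.memLp_stochGradAt (ih j).1)
    have hmix : ∀ f : Fin N → Ω → Param d, (∀ j, MemLp (f j) 2 P) →
        MemLp (fun ω => ∑ j, W i j • f j ω) 2 P := fun f hf =>
      memLp_finsetSum Finset.univ fun j _ => (hf j).const_smul (W i j)
    refine ⟨?_, hu i, ?_⟩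
    · have e : (fun ω => (stateAt F G W η β x₀ ξ (r + 1) ω).x i) = fun ω => _ :=
        funext fun ω => (hM.isRun η β x₀ ω).x_succ r i
      rw [e]
      exact (hmix _ fun j => (ih j).1).add (((hu i).sub (ih i).2.2).const_smul (-η))
    · have e : (fun ω => (stateAt F G W η β x₀ ξ (r + 1) ω).c i) = fun ω => _ :=
        funext fun ω => (hM.isRun η β x₀ ω).c_succ r i
      rw [e]
      exact (hmix _ fun j => (ih j).2.2.sub (hu j)).add (hu i)

theorem memLp_nodeAvg_x (hM : IsModel G W p D F L σ P ξ) (r : ℕ) :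
    MemLp (fun ω => nodeAvg (stateAt F G W η β x₀ ξ r ω).x) 2 P :=
  memLp_nodeAvg fun i => (hM.memLp_state r i).1

theorem memLp_virtualAt (hM : IsModel G W p D F L σ P ξ) (r : ℕ) :
    MemLp (virtualAt F G W η β x₀ ξ r) 2 P :=
  (hM.memLp_nodeAvg_x r).sub
    ((memLp_nodeAvg fun i => (hM.memLp_state r i).2.1).const_smul (η / (1 - β) * β))

theorem memLp_nodeAvg_localGradAt (hM : IsModel G W p D F L σ P ξ) (r : ℕ) :
    MemLp (fun ω => nodeAvg (localGradAt D F G W η β x₀ ξ r ω)) 2 P :=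
  memLp_nodeAvg fun i => hM.memLp_localGradAt (hM.memLp_state r i).1

theorem memLp_nodeAvg_stochGradAt (hM : IsModel G W p D F L σ P ξ) (r : ℕ) :
    MemLp (fun ω => nodeAvg (stochGradAt F G W η β x₀ ξ r ω)) 2 P :=
  memLp_nodeAvg fun i => hM.memLp_stochGradAt (hM.memLp_state r i).1

theorem memLp_nodeAvg_noiseAt (hM : IsModel G W p D F L σ P ξ) (r : ℕ) :
    MemLp (fun ω => nodeAvg (noiseAt D F G W η β x₀ ξ r ω)) 2 P :=
  memLp_nodeAvg fun i => hM.memLp_noiseAt r i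

theorem integrable_sqDev_x (hM : IsModel G W p D F L σ P ξ) (r : ℕ) :
    Integrable (fun ω => sqDev (stateAt F G W η β x₀ ξ r ω).x) P :=
  integrable_finsetSum _ fun i _ =>
    ((hM.memLp_state r i).1.sub (hM.memLp_nodeAvg_x r)).integrable_norm_pow two_ne_zero

/-! ### Orthogonality of the noise -/

theorem integral_inner_noiseAt (hM : IsModel G W p D F L σ P ξ) {r : ℕ} {i : Fin N}
    {V : Ω → Param d} (hVm : Measurable[otherSamples ξ i r] V) (hV : MemLp V 2 P) :
    ∫ ω, inner ℝ (V ω) (noiseAt D F G W η β x₀ ξ r ω i) ∂P = 0 := by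
  have hm : Measurable fun z : Param d × S i => stochGrad F i z.1 z.2 - localGrad D F i z.1 :=
    (measurable_stochGrad hM.regular i).sub
      ((continuous_localGrad hM.smooth hM.L_pos.le i).measurable.comp measurable_fst)
  have hZ : Measurable[otherSamples ξ i r]
      fun ω => (V ω, (stateAt F G W η β x₀ ξ r ω).x i) :=
    hVm.prodMk (measurable_stateAt_x hM.pos hM.mixing hM.regular r measurable_otherSamples_of_lt i)
  exact integral_inner_eq_zero_of_indepFun
    (hZ.mono (otherSamples_le hM.sampling i r) le_rfl) (hM.sampling.measurable i r)
    (indepFun_of_measurable_otherSamples hM.sampling i r hZ) (hM.sampling.law i r) hm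
    (fun x => (hM.regular.integrable_grad i x).sub (integrable_const (localGrad D F i x)))
    (fun x => by
      simp only
      rw [integral_sub (hM.regular.integrable_grad i x) (integrable_const _)]
      simp [localGrad])
    (integrable_inner_of_memLp hV (hM.memLp_noiseAt r i))

theorem integral_inner_nodeAvg_noiseAt (hM : IsModel G W p D F L σ P ξ) {r : ℕ}
    {V : Ω → Param d} (hVm : ∀ i, Measurable[otherSamples ξ i r] V) (hV : MemLp V 2 P) :
    ∫ ω, inner ℝ (V ω) (nodeAvg (noiseAt D F G W η β x₀ ξ r ω)) ∂P = 0 := by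
  simp only [nodeAvg, real_inner_smul_right, inner_sum]
  rw [integral_const_mul, integral_finsetSum _ fun i _ =>
    integrable_inner_of_memLp hV (hM.memLp_noiseAt r i)]
  simp [fun i => hM.integral_inner_noiseAt (η := η) (β := β) (x₀ := x₀) (hVm i) hV]

/-- Averaging over the nodes divides the variance by `N`. -/
theorem integral_sq_norm_nodeAvg_noiseAt_le (hM : IsModel G W p D F L σ P ξ) (r : ℕ) :
    ∫ ω, ‖nodeAvg (noiseAt D F G W η β x₀ ξ r ω)‖ ^ 2 ∂P ≤ σ ^ 2 / N := by
  have hN : (0 : ℝ) < N := by exact_mod_cast hM.pos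
  have h1 : ∀ ω, ‖nodeAvg (noiseAt D F G W η β x₀ ξ r ω)‖ ^ 2 = (N : ℝ)⁻¹ * ∑ i,
      inner ℝ (nodeAvg (noiseAt D F G W η β x₀ ξ r ω)) (noiseAt D F G W η β x₀ ξ r ω i) := by
    intro ω
    rw [← real_inner_self_eq_norm_sq, ← inner_sum, ← real_inner_smul_right]
    rfl
  have h2 : ∀ i, ∫ ω, inner ℝ (nodeAvg (noiseAt D F G W η β x₀ ξ r ω))
      (noiseAt D F G W η β x₀ ξ r ω i) ∂P ≤ (N : ℝ)⁻¹ * σ ^ 2 := by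
    intro i
    simp only [nodeAvg, real_inner_smul_left, sum_inner]
    rw [integral_const_mul, integral_finsetSum _ fun j _ =>
      integrable_inner_of_memLp (hM.memLp_noiseAt r j) (hM.memLp_noiseAt r i)]
    gcongr
    rw [Finset.sum_eq_single i]
    · simpa only [real_inner_self_eq_norm_sq] using (hM.noise_moments r i).2
    -- A cross term between two nodes of the same round: the noise of node `j` is a function of
    -- samples other than that of node `i`, so it serves as the test vector.
    · intro j _ hj
      refine hM.integral_inner_noiseAt (measurable_noiseAt hM.pos hM.mixing
        hM.regular hM.smooth hM.L_pos.le r measurable_otherSamples_of_lt j ?_)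
        (hM.memLp_noiseAt r j)
      exact measurable_otherSamples ξ fun h => hj (Prod.ext_iff.1 h).1
    · simp
  simp only [h1]
  rw [integral_const_mul, integral_finsetSum _ fun i _ =>
    integrable_inner_of_memLp (hM.memLp_nodeAvg_noiseAt r) (hM.memLp_noiseAt r i)]
  calc _ ≤ (N : ℝ)⁻¹ * ∑ _i : Fin N, (N : ℝ)⁻¹ * σ ^ 2 := by
        gcongr with i
        exact h2 i
    _ = _ := by
        simp only [Finset.sum_const, Finset.card_univ, Fintype.card_fin, nsmul_eq_mul]
        field_simp

theorem integral_sq_norm_nodeAvg_stochGradAt_le (hM : IsModel G W p D F L σ P ξ) (r : ℕ) :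
    ∫ ω, ‖nodeAvg (stochGradAt F G W η β x₀ ξ r ω)‖ ^ 2 ∂P
      ≤ ∫ ω, ‖nodeAvg (localGradAt D F G W η β x₀ ξ r ω)‖ ^ 2 ∂P + σ ^ 2 / N := by
  have hq := hM.memLp_nodeAvg_localGradAt (η := η) (β := β) (x₀ := x₀) r
  have hn := hM.memLp_nodeAvg_noiseAt (η := η) (β := β) (x₀ := x₀) r
  have hq2 := hq.integrable_norm_pow two_ne_zero
  have hn2 := hn.integrable_norm_pow two_ne_zero
  have hqn := (integrable_inner_of_memLp hq hn).const_mul 2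
  have hsum : Integrable (fun ω => ‖nodeAvg (localGradAt D F G W η β x₀ ξ r ω)‖ ^ 2
      + 2 * inner ℝ (nodeAvg (localGradAt D F G W η β x₀ ξ r ω))
        (nodeAvg (noiseAt D F G W η β x₀ ξ r ω))) P := hq2.add hqn
  have hzero := hM.integral_inner_nodeAvg_noiseAt (η := η) (β := β) (x₀ := x₀)
    (fun i => measurable_nodeAvg fun j => measurable_localGradAt hM.pos hM.mixing hM.regular
      hM.smooth hM.L_pos.le r (measurable_otherSamples_of_lt (i := i)) j) hq
  simp only [nodeAvg_stochGradAt_eq (D := D), norm_add_sq_real]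
  rw [integral_add hsum hn2, integral_add hq2 hqn, integral_const_mul]
  erw [hzero]
  linarith [hM.integral_sq_norm_nodeAvg_noiseAt_le (η := η) (β := β) (x₀ := x₀) r]

/-- The virtual iterate involves only `x̄` and `ū`, hence only samples of earlier rounds, so the
averaged noise is orthogonal to the gradient there. -/
theorem integral_inner_globalGrad_virtualAt (hM : IsModel G W p D F L σ P ξ) (r : ℕ) :
    ∫ ω, inner ℝ (globalGrad D F (virtualAt F G W η β x₀ ξ r ω))
        (nodeAvg (stochGradAt F G W η β x₀ ξ r ω)) ∂P
      = ∫ ω, inner ℝ (globalGrad D F (virtualAt F G W η β x₀ ξ r ω))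
        (nodeAvg (localGradAt D F G W η β x₀ ξ r ω)) ∂P := by
  have hz := hM.memLp_globalGrad (hM.memLp_virtualAt (η := η) (β := β) (x₀ := x₀) r)
  have hc := continuous_of_norm_sub_le
    (norm_globalGrad_sub_le hM.pos hM.smooth hM.L_pos.le) hM.L_pos.le
  have hzm : ∀ i, Measurable[otherSamples ξ i r]
      fun ω => globalGrad D F (virtualAt F G W η β x₀ ξ r ω) := fun i =>
    hc.measurable.comp (measurable_virtualAt hM.pos hM.mixing hM.regular r
      measurable_otherSamples_of_lt)
  simp only [nodeAvg_stochGradAt_eq (D := D), inner_add_right]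
  rw [integral_add (integrable_inner_of_memLp hz (hM.memLp_nodeAvg_localGradAt r))
      (integrable_inner_of_memLp hz (hM.memLp_nodeAvg_noiseAt r)),
    hM.integral_inner_nodeAvg_noiseAt (fun i => hzm i) hz, add_zero]

end IsModel

end

end MomentumTracking

/-! ### Combining the estimates -/

namespace MomentumTracking

noncomputable section

/-- The algebra that combines the descent inequality with the bounds on the consensus distance `X`
and on the distance `z` to the virtual iterates. -/
theorem rate_of_accumulated_bounds {L a p β r₀ v N Z Q G X z E T : ℝ} (hL : 0 < L) (ha : 0 < a)
    (hp : 0 < p) (hp1 : p ≤ 1) (hβ0 : 0 ≤ β) (hβ : β < 1) (hv : 0 ≤ v) (hN : 1 ≤ N)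
    (hr₀ : 0 ≤ r₀) (hZ : 0 ≤ Z) (hQ : 0 ≤ Q)
    (haL : 36 * (L * a) ≤ p ^ 2 * (1 - β))
    (hdesc : 0 ≤ r₀ - a * E + L * a ^ 2 * G)
    (hE : Z + Q - 2 * L ^ 2 * z - 2 * L ^ 2 * (X / N) ≤ 2 * E)
    (hG : G ≤ Q + v / N)
    (hX : X ≤ 32 * (a ^ 2 / p ^ 4) * (9 * L ^ 2 * N * (a ^ 2 * G) + 6 * (N * v)))
    (hz : z ≤ a ^ 2 * β ^ 2 / (1 - β) ^ 2 * G)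
    (hT : T ≤ 2 * Z + 2 * L ^ 2 * z) :
    T ≤ 2000 * (r₀ / a + L * a * v / N
      + L ^ 2 * a ^ 2 * (1 / (p ^ 4 * (1 - β)) * (1 + p * β ^ 2 / (1 - β))) * v) := by
  have h1 : 0 < 1 - β := by linarith
  have hN0 : 0 < N := by linarith
  set t := L * a with ht
  have ht0 : 0 < t := mul_pos hL ha
  have hp2 : p ^ 2 ≤ 1 := pow_le_one₀ hp.le hp1
  have ht1 : t ≤ (1 - β) / 36 := by nlinarith
  have ht2 : t ≤ p ^ 2 / 36 := by nlinarith [sq_nonneg p]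
  have ht3 : t ≤ 1 / 36 := by linarith
  set b := β ^ 2 / (1 - β) ^ 2 with hb
  set c := t ^ 2 / p ^ 4 with hc
  have hb0 : 0 ≤ b := by positivity
  have hc0 : 0 ≤ c := by positivity
  have htb : t ^ 2 * b ≤ 1 / 1296 := by
    rw [hb, ← mul_div_assoc, div_le_iff₀ (by positivity)]
    have e1 : t ^ 2 ≤ ((1 - β) / 36) ^ 2 := pow_le_pow_left₀ ht0.le ht1 2
    have e2 : β ^ 2 ≤ 1 := pow_le_one₀ hβ0 hβ.le
    nlinarith [mul_le_mul e1 e2 (sq_nonneg _) (sq_nonneg _)]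
  have hc1 : c ≤ 1 / 1296 := by
    rw [hc, div_le_iff₀ (by positivity)]
    nlinarith [pow_le_pow_left₀ ht0.le ht2 2]
  have htc : t ^ 2 ≤ c := by
    rw [hc, le_div_iff₀ (by positivity)]
    exact mul_le_of_le_one_right (sq_nonneg _) (pow_le_one₀ hp.le hp1)
  set w := v / N with hw
  have hw0 : 0 ≤ w := by positivity
  have hwv : w ≤ v := div_le_self hv hN
  set B := 1 / (p ^ 4 * (1 - β)) * (1 + p * β ^ 2 / (1 - β)) with hB
  have hB' : B = 1 / (p ^ 4 * (1 - β)) + b / p ^ 3 := by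
    rw [hB, hb]; field_simp
  have hpow : ∀ k : ℕ, p ^ k ≤ 1 := fun k => pow_le_one₀ hp.le hp1
  have hB1 : 1 / p ^ 4 ≤ 1 / (p ^ 4 * (1 - β)) := by
    apply one_div_le_one_div_of_le (by positivity)
    exact mul_le_of_le_one_right (by positivity) (by linarith)
  have hB2 : b ≤ b / p ^ 3 := le_div_self hb0 (by positivity) (hpow 3)
  -- The estimates produce only `1 / p⁴ + β² / (1 - β)²`; the coefficient `B` of the stated rate is
  -- larger.
  have hcB : c + t ^ 2 * b ≤ t ^ 2 * B := by
    rw [hB', mul_add, hc, div_eq_mul_one_div]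
    gcongr
  -- the two error terms
  have hzL : L ^ 2 * z ≤ t ^ 2 * b * (Q + w) := by
    have e1 := mul_le_mul_of_nonneg_left hz (sq_nonneg L)
    have e2 : L ^ 2 * (a ^ 2 * β ^ 2 / (1 - β) ^ 2 * G) = t ^ 2 * b * G := by
      rw [hb, ht]; ring
    rw [e2] at e1
    exact e1.trans (mul_le_mul_of_nonneg_left hG (by positivity))
  have hXL : L ^ 2 * (X / N) ≤ 288 * (c * t ^ 2) * (Q + w) + 192 * c * v := by
    have e1 : X / N ≤ 32 * (a ^ 2 / p ^ 4) * (9 * L ^ 2 * a ^ 2 * G + 6 * v) := by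
      rw [div_le_iff₀ hN0]
      refine hX.trans (le_of_eq ?_)
      ring
    have e2 := mul_le_mul_of_nonneg_left e1 (sq_nonneg L)
    have e3 : L ^ 2 * (32 * (a ^ 2 / p ^ 4) * (9 * L ^ 2 * a ^ 2 * G + 6 * v))
        = 288 * (c * t ^ 2) * G + 192 * c * v := by
      rw [hc, ht]; ring
    rw [e3] at e2
    have e4 : 288 * (c * t ^ 2) * G ≤ 288 * (c * t ^ 2) * (Q + w) :=
      mul_le_mul_of_nonneg_left hG (by positivity)
    linarith
  have hE' : E ≤ r₀ / a + t * (Q + w) := by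
    have e1 : E ≤ r₀ / a + t * G := by
      have : a * E ≤ a * (r₀ / a + t * G) := by
        have e2 : a * (t * G) = L * a ^ 2 * G := by rw [ht]; ring
        rw [mul_add, mul_div_cancel₀ _ ha.ne', e2]
        linarith
      exact le_of_mul_le_mul_left this ha
    exact e1.trans (by gcongr)
  have hra : 0 ≤ r₀ / a := by positivity
  have hQw : 0 ≤ Q + w := by positivity
  have f1 : t ^ 2 * b * Q ≤ 1 / 1296 * Q := mul_le_mul_of_nonneg_right htb hQ
  have f2 : t * Q ≤ 1 / 36 * Q := mul_le_mul_of_nonneg_right ht3 hQ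
  have f3 : c * t ^ 2 ≤ 1 / 1296 * t ^ 2 := mul_le_mul_of_nonneg_right hc1 (sq_nonneg _)
  have f4 : c * t ^ 2 * Q ≤ 1 / 1296 * (1 / 1296) * Q := by
    refine mul_le_mul_of_nonneg_right ?_ hQ
    exact mul_le_mul hc1 (htc.trans hc1) (sq_nonneg _) (by norm_num)
  have f5 : c * t ^ 2 * w ≤ c * v := by
    refine mul_le_mul ?_ hwv hw0 hc0
    exact mul_le_of_le_one_right hc0 (by linarith [htc.trans hc1])
  have f6 : t ^ 2 * b * w ≤ t ^ 2 * b * v := mul_le_mul_of_nonneg_left hwv (by positivity)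
  have f7 := mul_le_mul_of_nonneg_right hcB hv
  have g1 : L * a * v / N = t * w := by rw [hw, mul_div_assoc]
  have g2 : L ^ 2 * a ^ 2 * B * v = t ^ 2 * B * v := by rw [ht]; ring
  have f8 : 0 ≤ t * w := by positivity
  have f9 : 0 ≤ c * v := by positivity
  have f10 : 0 ≤ t ^ 2 * b * v := by positivity
  rw [g1, g2]
  -- The terms in `Q` have total coefficient at most `2/36 + 2/1296 + 576/1296²`, which is below
  -- `1/2` and is absorbed. The `960` is `576 + 384` from the consensus bound; doubling it gives
  -- `1920`, the source of `2000`.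
  have hZQ : Z + Q / 2 ≤ 2 * (r₀ / a) + 2 * (t * w) + 2 * (t ^ 2 * b * v) + 960 * (c * v) := by
    linarith
  have hT' : T ≤ 2 * (Z + Q / 2) + 2 * (t ^ 2 * b * v) := by linarith
  linarith

/-- The choice of the step size. -/
theorem exists_stepsize {r₀ a₀ R A B M₁ M₃ : ℝ} (hr : 0 < r₀) (ha₀ : 0 < a₀) (hR : 0 < R)
    (hM₁ : 0 ≤ M₁) (hM₃ : 0 ≤ M₃) (h₁ : M₁ ^ 2 = r₀ * A / R) (h₃ : M₃ ^ 3 = r₀ ^ 2 * B / R ^ 2) :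
    ∃ a, 0 < a ∧ a ≤ a₀ ∧
      r₀ / (a * R) + A * a + B * a ^ 2 ≤ r₀ / (a₀ * R) + 2 * M₁ + 2 * M₃ := by
  set A₁ := M₁ * R / r₀ with hA₁
  set A₃ := M₃ * R / r₀ with hA₃
  have h1 : 0 ≤ A₁ := by positivity
  have h3 : 0 ≤ A₃ := by positivity
  have h0 : 0 < 1 / a₀ := by positivity
  -- The reciprocal of a sum replaces a minimum of the three candidates `a₀`, `1 / A₁`, `1 / A₃`: it
  -- lies below each of them, while `r₀ / (a R)` splits exactly into `r₀ / (a₀ R) + M₁ + M₃`.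
  set s := 1 / a₀ + A₁ + A₃ with hs
  have hs0 : 0 < s := by positivity
  have e1 : A₁ / s ≤ 1 := (div_le_one hs0).2 (by rw [hs]; linarith)
  have e3 : A₃ / s ≤ 1 := (div_le_one hs0).2 (by rw [hs]; linarith)
  have hA : A = M₁ * A₁ := by
    rw [hA₁, ← mul_div_assoc, ← mul_assoc, ← sq, h₁]; field_simp
  have hB : B = M₃ * A₃ ^ 2 := by
    rw [hA₃]
    have : M₃ * (M₃ * R / r₀) ^ 2 = M₃ ^ 3 * (R / r₀) ^ 2 := by ring
    rw [this, h₃]; field_simp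
  refine ⟨1 / s, by positivity, ?_, ?_⟩
  · rw [one_div_le hs0 ha₀, hs]; linarith
  · have f1 : r₀ / (1 / s * R) = r₀ / (a₀ * R) + M₁ + M₃ := by
      rw [hs, hA₁, hA₃]; field_simp
    have f2 : A * (1 / s) ≤ M₁ := by
      rw [hA, mul_assoc, mul_one_div]
      exact mul_le_of_le_one_right hM₁ e1
    have f3 : B * (1 / s) ^ 2 ≤ M₃ := by
      have : B * (1 / s) ^ 2 = M₃ * (A₃ / s) ^ 2 := by rw [hB]; ring
      rw [this]
      exact mul_le_of_le_one_right hM₃ (pow_le_one₀ (by positivity) e3)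
    linarith

variable {N d : ℕ} {S : Fin N → Type*} [∀ i, MeasurableSpace (S i)]
  {G : SimpleGraph (Fin N)} {W : Matrix (Fin N) (Fin N) ℝ} {p : ℝ}
  {D : ∀ i, Measure (S i)} {F : ∀ i, Param d → S i → ℝ}
  {L σ : ℝ} {Ω : Type*} [mΩ : MeasurableSpace Ω] {P : Measure Ω}
  {ξ : ∀ i, ℕ → Ω → S i} {η β : ℝ} {x₀ : Param d}

namespace IsModel

variable [∀ i, IsProbabilityMeasure (D i)]

/-- The descent inequality along the virtual iterates of one sample path. -/
theorem descent (hM : IsModel G W p D F L σ P ξ) {fstar : ℝ}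
    (hf : ∀ x, fstar ≤ globalObj D F x) (hβ : β < 1) (R : ℕ) (ω : Ω) :
    0 ≤ globalObj D F x₀ - fstar + ∑ r ∈ Finset.range R,
      (-(η / (1 - β)) * inner ℝ (globalGrad D F (virtualAt F G W η β x₀ ξ r ω))
          (nodeAvg (stochGradAt F G W η β x₀ ξ r ω))
        + L * (η / (1 - β)) ^ 2 * ‖nodeAvg (stochGradAt F G W η β x₀ ξ r ω)‖ ^ 2) := by
  have hrun := hM.isRun η β x₀ ω
  have key : globalObj D F (virtualAt F G W η β x₀ ξ R ω)
      ≤ globalObj D F x₀ + ∑ r ∈ Finset.range R,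
      (-(η / (1 - β)) * inner ℝ (globalGrad D F (virtualAt F G W η β x₀ ξ r ω))
          (nodeAvg (stochGradAt F G W η β x₀ ξ r ω))
        + L * (η / (1 - β)) ^ 2 * ‖nodeAvg (stochGradAt F G W η β x₀ ξ r ω)‖ ^ 2) := by
    induction R with
    | zero =>
      rw [virtualAt, hrun.virtual_zero hM.pos]; simp
    | succ R ih =>
      rw [Finset.sum_range_succ]
      have h1 := abs_globalObj_sub_linearization_le hM.pos hM.regular hM.L_pos.le hM.smooth
        hM.variance (virtualAt F G W η β x₀ ξ R ω)
        (-((η / (1 - β)) • nodeAvg (stochGradAt F G W η β x₀ ξ R ω)))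
      have h2 : virtualAt F G W η β x₀ ξ R ω
          + -((η / (1 - β)) • nodeAvg (stochGradAt F G W η β x₀ ξ R ω))
          = virtualAt F G W η β x₀ ξ (R + 1) ω := by
        rw [← sub_eq_add_neg]
        exact (hrun.virtual_succ hM.pos hM.mixing hβ R).symm
      rw [h2, inner_neg_right, real_inner_smul_right, norm_neg, norm_smul, mul_pow,
        Real.norm_eq_abs, sq_abs] at h1
      have h3 := (abs_le.1 h1).2
      linarith
  linarith [hf (virtualAt F G W η β x₀ ξ R ω)]

variable [IsProbabilityMeasure P]

/-- Half of the cross term in the descent inequality consists of squared gradients, up to the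
consensus distance and the distance to the virtual iterate. -/
theorem two_mul_integral_inner_ge (hM : IsModel G W p D F L σ P ξ) (r : ℕ) :
    ∫ ω, ‖globalGrad D F (virtualAt F G W η β x₀ ξ r ω)‖ ^ 2 ∂P
      + ∫ ω, ‖nodeAvg (localGradAt D F G W η β x₀ ξ r ω)‖ ^ 2 ∂P
      - 2 * L ^ 2 * ∫ ω, ‖virtualAt F G W η β x₀ ξ r ω
          - nodeAvg (stateAt F G W η β x₀ ξ r ω).x‖ ^ 2 ∂P
      - 2 * L ^ 2 * ((∫ ω, sqDev (stateAt F G W η β x₀ ξ r ω).x ∂P) / N)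
      ≤ 2 * ∫ ω, inner ℝ (globalGrad D F (virtualAt F G W η β x₀ ξ r ω))
        (nodeAvg (stochGradAt F G W η β x₀ ξ r ω)) ∂P := by
  have hN : (0 : ℝ) < N := by exact_mod_cast hM.pos
  have hz := hM.memLp_virtualAt (η := η) (β := β) (x₀ := x₀) r
  have hx := hM.memLp_nodeAvg_x (η := η) (β := β) (x₀ := x₀) r
  have hq := hM.memLp_nodeAvg_localGradAt (η := η) (β := β) (x₀ := x₀) r
  have hgz := hM.memLp_globalGrad hz
  have i1 := hgz.integrable_norm_pow two_ne_zero
  have i2 := hq.integrable_norm_pow two_ne_zero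
  have i3 : Integrable (fun ω => 2 * L ^ 2 * ‖virtualAt F G W η β x₀ ξ r ω
      - nodeAvg (stateAt F G W η β x₀ ξ r ω).x‖ ^ 2) P :=
    ((hz.sub hx).integrable_norm_pow two_ne_zero).const_mul _
  have i4 := ((hM.integrable_sqDev_x (η := η) (β := β) (x₀ := x₀) r).div_const (N : ℝ)).const_mul
    (2 * L ^ 2)
  have i5 := (integrable_inner_of_memLp hgz hq).const_mul 2
  have i12 : Integrable (fun ω => ‖globalGrad D F (virtualAt F G W η β x₀ ξ r ω)‖ ^ 2
      + ‖nodeAvg (localGradAt D F G W η β x₀ ξ r ω)‖ ^ 2) P := i1.add i2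
  have i123 : Integrable (fun ω => ‖globalGrad D F (virtualAt F G W η β x₀ ξ r ω)‖ ^ 2
      + ‖nodeAvg (localGradAt D F G W η β x₀ ξ r ω)‖ ^ 2
      - 2 * L ^ 2 * ‖virtualAt F G W η β x₀ ξ r ω
        - nodeAvg (stateAt F G W η β x₀ ξ r ω).x‖ ^ 2) P := i12.sub i3
  rw [hM.integral_inner_globalGrad_virtualAt, ← integral_const_mul, ← integral_const_mul,
    ← integral_div, ← integral_const_mul, ← integral_add i1 i2, ← integral_sub i12 i3,
    ← integral_sub i123 i4]
  refine integral_mono (i123.sub i4) i5 fun ω => ?_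
  set z := virtualAt F G W η β x₀ ξ r ω
  set x := (stateAt F G W η β x₀ ξ r ω).x with hxdef
  set q := nodeAvg (localGradAt D F G W η β x₀ ξ r ω) with hqdef
  have h1 : ‖globalGrad D F z - globalGrad D F (nodeAvg x)‖ ^ 2 ≤ L ^ 2 * ‖z - nodeAvg x‖ ^ 2 := by
    rw [← mul_pow]
    exact pow_le_pow_left₀ (norm_nonneg _)
      (norm_globalGrad_sub_le hM.pos hM.smooth hM.L_pos.le _ _) 2
  have h2 : ‖globalGrad D F (nodeAvg x) - q‖ ^ 2 ≤ L ^ 2 * (sqDev x / N) := by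
    rw [← mul_div_assoc, le_div_iff₀' hN]
    exact mul_sq_norm_globalGrad_sub_le hM.pos hM.smooth (nodeAvg x) x
  have h3 : ‖globalGrad D F z - q‖ ^ 2 ≤ 2 * ‖globalGrad D F z - globalGrad D F (nodeAvg x)‖ ^ 2
      + 2 * ‖globalGrad D F (nodeAvg x) - q‖ ^ 2 := by
    have := sq_norm_add_le (t := 1 / 2) (by norm_num) (by norm_num)
      (globalGrad D F z - globalGrad D F (nodeAvg x)) (globalGrad D F (nodeAvg x) - q)
    norm_num at this
    exact this
  have h4 := norm_sub_sq_real (globalGrad D F z) q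
  simp only
  linarith

theorem integral_sq_norm_globalGrad_le (hM : IsModel G W p D F L σ P ξ) (r : ℕ) :
    ∫ ω, ‖globalGrad D F (nodeAvg (stateAt F G W η β x₀ ξ r ω).x)‖ ^ 2 ∂P
      ≤ 2 * ∫ ω, ‖globalGrad D F (virtualAt F G W η β x₀ ξ r ω)‖ ^ 2 ∂P
        + 2 * L ^ 2 * ∫ ω, ‖virtualAt F G W η β x₀ ξ r ω
          - nodeAvg (stateAt F G W η β x₀ ξ r ω).x‖ ^ 2 ∂P := by
  have hz := hM.memLp_virtualAt (η := η) (β := β) (x₀ := x₀) r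
  have hx := hM.memLp_nodeAvg_x (η := η) (β := β) (x₀ := x₀) r
  have i1 := ((hM.memLp_globalGrad hz).integrable_norm_pow two_ne_zero).const_mul 2
  have i3 : Integrable (fun ω => 2 * L ^ 2 * ‖virtualAt F G W η β x₀ ξ r ω
      - nodeAvg (stateAt F G W η β x₀ ξ r ω).x‖ ^ 2) P :=
    ((hz.sub hx).integrable_norm_pow two_ne_zero).const_mul _
  rw [← integral_const_mul, ← integral_const_mul, ← integral_add i1 i3]
  refine integral_mono ((hM.memLp_globalGrad hx).integrable_norm_pow two_ne_zero) (i1.add i3)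
    fun ω => ?_
  set z := virtualAt F G W η β x₀ ξ r ω
  set y := nodeAvg (stateAt F G W η β x₀ ξ r ω).x
  have h1 : ‖globalGrad D F z - globalGrad D F y‖ ^ 2 ≤ L ^ 2 * ‖z - y‖ ^ 2 := by
    rw [← mul_pow]
    exact pow_le_pow_left₀ (norm_nonneg _)
      (norm_globalGrad_sub_le hM.pos hM.smooth hM.L_pos.le _ _) 2
  have h3 := sq_norm_add_le (t := 1 / 2) (by norm_num) (by norm_num)
      (globalGrad D F z) (-(globalGrad D F z - globalGrad D F y))
  norm_num at h3
  rw [norm_sub_rev] at h3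
  simp only
  linarith

/-- The bound on the accumulated squared gradients for a given effective step size `a`. -/
theorem sum_integral_sq_norm_globalGrad_le (hM : IsModel G W p D F L σ P ξ) {fstar : ℝ}
    (hf : ∀ x, fstar ≤ globalObj D F x) (hβ0 : 0 ≤ β) (hβ : β < 1) {a : ℝ} (ha : 0 < a)
    (haη : a = η / (1 - β)) (haL : 36 * (L * a) ≤ p ^ 2 * (1 - β)) (n : ℕ) :
    ∑ r ∈ Finset.range (n + 1),
      ∫ ω, ‖globalGrad D F (nodeAvg (stateAt F G W η β x₀ ξ r ω).x)‖ ^ 2 ∂P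
      ≤ 2000 * ((globalObj D F x₀ - fstar) / a + L * a * ((n + 1 : ℕ) * σ ^ 2) / N
        + L ^ 2 * a ^ 2 * (1 / (p ^ 4 * (1 - β)) * (1 + p * β ^ 2 / (1 - β)))
          * ((n + 1 : ℕ) * σ ^ 2)) := by
  have hN : (0 : ℝ) < N := by exact_mod_cast hM.pos
  have hg2 := fun r => (hM.memLp_nodeAvg_stochGradAt (η := η) (β := β) (x₀ := x₀) r
    ).integrable_norm_pow two_ne_zero
  have hzx : ∀ r, Integrable (fun ω => ‖virtualAt F G W η β x₀ ξ r ω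
      - nodeAvg (stateAt F G W η β x₀ ξ r ω).x‖ ^ 2) P := fun r =>
    ((hM.memLp_virtualAt r).sub (hM.memLp_nodeAvg_x r)).integrable_norm_pow two_ne_zero
  have hsum : ∑ r ∈ Finset.range (n + 1), (σ ^ 2 : ℝ) = (n + 1 : ℕ) * σ ^ 2 := by simp
  -- Here `v` is the total noise budget `(n + 1) σ²`, and all other quantities are sums over the
  -- rounds.
  refine rate_of_accumulated_bounds (N := N)
    (Z := ∑ r ∈ Finset.range (n + 1),
      ∫ ω, ‖globalGrad D F (virtualAt F G W η β x₀ ξ r ω)‖ ^ 2 ∂P)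
    (Q := ∑ r ∈ Finset.range (n + 1),
      ∫ ω, ‖nodeAvg (localGradAt D F G W η β x₀ ξ r ω)‖ ^ 2 ∂P)
    (G := ∑ r ∈ Finset.range (n + 1),
      ∫ ω, ‖nodeAvg (stochGradAt F G W η β x₀ ξ r ω)‖ ^ 2 ∂P)
    (X := ∑ r ∈ Finset.range (n + 1), ∫ ω, sqDev (stateAt F G W η β x₀ ξ r ω).x ∂P)
    (z := ∑ r ∈ Finset.range (n + 1), ∫ ω, ‖virtualAt F G W η β x₀ ξ r ω
          - nodeAvg (stateAt F G W η β x₀ ξ r ω).x‖ ^ 2 ∂P)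
    (E := ∑ r ∈ Finset.range (n + 1),
      ∫ ω, inner ℝ (globalGrad D F (virtualAt F G W η β x₀ ξ r ω))
        (nodeAvg (stochGradAt F G W η β x₀ ξ r ω)) ∂P)
    hM.L_pos ha hM.p_pos hM.p_le_one hβ0 hβ (by positivity) (by exact_mod_cast hM.pos)
    (sub_nonneg.2 (hf x₀)) (Finset.sum_nonneg fun _ _ => integral_nonneg fun _ => sq_nonneg _)
    (Finset.sum_nonneg fun _ _ => integral_nonneg fun _ => sq_nonneg _) haL ?_ ?_ ?_ ?_ ?_ ?_
  · have hin := fun r => (integrable_inner_of_memLp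
      (hM.memLp_globalGrad (hM.memLp_virtualAt (η := η) (β := β) (x₀ := x₀) r))
      (hM.memLp_nodeAvg_stochGradAt (η := η) (β := β) (x₀ := x₀) r))
    have hterm : ∀ r, Integrable (fun ω =>
        -a * inner ℝ (globalGrad D F (virtualAt F G W η β x₀ ξ r ω))
          (nodeAvg (stochGradAt F G W η β x₀ ξ r ω))
        + L * a ^ 2 * ‖nodeAvg (stochGradAt F G W η β x₀ ξ r ω)‖ ^ 2) P := fun r => ((hin r).const_mul (-a)).add ((hg2 r).const_mul (L * a ^ 2))
    have hint : ∫ ω, (globalObj D F x₀ - fstar + ∑ r ∈ Finset.range (n + 1),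
      (-a * inner ℝ (globalGrad D F (virtualAt F G W η β x₀ ξ r ω))
          (nodeAvg (stochGradAt F G W η β x₀ ξ r ω))
        + L * a ^ 2 * ‖nodeAvg (stochGradAt F G W η β x₀ ξ r ω)‖ ^ 2)) ∂P
        = globalObj D F x₀ - fstar + ∑ r ∈ Finset.range (n + 1),
          (-a * ∫ ω, inner ℝ (globalGrad D F (virtualAt F G W η β x₀ ξ r ω))
            (nodeAvg (stochGradAt F G W η β x₀ ξ r ω)) ∂P
          + L * a ^ 2 * ∫ ω, ‖nodeAvg (stochGradAt F G W η β x₀ ξ r ω)‖ ^ 2 ∂P) := by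
      rw [integral_add (integrable_const _) (integrable_finsetSum _ fun r _ => hterm r),
        integral_finsetSum _ fun r _ => hterm r]
      simp only [integral_const, probReal_univ, one_smul]
      congr 1
      refine Finset.sum_congr rfl fun r _ => ?_
      rw [integral_add ((hin r).const_mul (-a)) ((hg2 r).const_mul (L * a ^ 2)),
        integral_const_mul, integral_const_mul]
    have h0 := integral_nonneg (μ := P) (f := fun ω => globalObj D F x₀ - fstar
      + ∑ r ∈ Finset.range (n + 1),
        (-a * inner ℝ (globalGrad D F (virtualAt F G W η β x₀ ξ r ω))
            (nodeAvg (stochGradAt F G W η β x₀ ξ r ω))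
          + L * a ^ 2 * ‖nodeAvg (stochGradAt F G W η β x₀ ξ r ω)‖ ^ 2)) fun ω => by
      have := hM.descent (η := η) (x₀ := x₀) hf hβ (n + 1) ω
      rwa [← haη] at this
    rw [hint] at h0
    rw [Finset.sum_add_distrib, ← Finset.mul_sum, ← Finset.mul_sum] at h0
    linarith
  · have h := Finset.sum_le_sum fun r (_ : r ∈ Finset.range (n + 1)) =>
      hM.two_mul_integral_inner_ge (η := η) (β := β) (x₀ := x₀) r
    simp only [Finset.sum_sub_distrib, Finset.sum_add_distrib, ← Finset.mul_sum,
      ← Finset.sum_div] at h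
    exact h
  · have h := Finset.sum_le_sum fun r (_ : r ∈ Finset.range (n + 1)) =>
      hM.integral_sq_norm_nodeAvg_stochGradAt_le (η := η) (β := β) (x₀ := x₀) r
    simp only [Finset.sum_add_distrib, ← Finset.sum_div, hsum] at h
    exact h
  · have hnn : ∀ r, Integrable (fun ω => ∑ i, ‖noiseAt D F G W η β x₀ ξ r ω i‖ ^ 2) P := fun r =>
      integrable_finsetSum _ fun i _ => (hM.noise_moments r i).1
    -- The consensus bound holds on every path and is only now integrated.
    have hpath := fun ω => (hM.isRun η β x₀ ω).sum_sqDev_x_le_of_stepsize hM.pos hM.mixing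
      hM.p_pos hM.p_le_one hM.contracts hβ0 hβ hM.L_pos.le
      (q := fun r => localGradAt D F G W η β x₀ ξ r ω) (fun r i => hM.smooth i _ _) ha.le haη
      (haL.trans (mul_le_of_le_one_right (sq_nonneg _) (by linarith))) n
    have hi1 := (((integrable_finsetSum (Finset.range (n + 1)) fun r _ => hg2 r).const_mul
      (a ^ 2)).const_mul (9 * L ^ 2 * N))
    have hi2 := ((integrable_finsetSum (Finset.range (n + 1)) fun r _ => hnn r).const_mul 6)
    have h := integral_mono (μ := P)
      (integrable_finsetSum (Finset.range (n + 1)) fun r _ => hM.integrable_sqDev_x r)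
      ((hi1.add hi2).const_mul (32 * (a ^ 2 / p ^ 4))) hpath
    simp only [Pi.add_apply] at h
    rw [integral_finsetSum _ fun r _ => hM.integrable_sqDev_x r, integral_const_mul,
      integral_add hi1 hi2, integral_const_mul, integral_const_mul, integral_const_mul,
      integral_finsetSum _ fun r _ => hg2 r, integral_finsetSum _ fun r _ => hnn r] at h
    have hp := hM.p_pos
    refine h.trans ?_
    gcongr
    rw [← hsum, Finset.mul_sum]
    refine Finset.sum_le_sum fun r _ => ?_
    rw [integral_finsetSum _ fun i _ => (hM.noise_moments r i).1]
    refine (Finset.sum_le_sum fun i _ => (hM.noise_moments r i).2).trans (le_of_eq ?_)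
    simp
  · have h := integral_mono (μ := P)
      (integrable_finsetSum (Finset.range (n + 1)) fun r _ => hzx r)
      ((integrable_finsetSum (Finset.range (n + 1)) fun r _ => hg2 r).const_mul
        (a ^ 2 * β ^ 2 / (1 - β) ^ 2))
      (fun ω => by
        have := (hM.isRun η β x₀ ω).sum_sq_virtual_sub_le hM.pos hβ0 hβ n
        rw [← haη] at this
        exact this)
    rw [integral_finsetSum _ fun r _ => hzx r, integral_const_mul,
      integral_finsetSum _ fun r _ => hg2 r] at h
    exact h
  · have h := Finset.sum_le_sum fun r (_ : r ∈ Finset.range (n + 1)) =>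
      hM.integral_sq_norm_globalGrad_le (η := η) (β := β) (x₀ := x₀) r
    simpa only [Finset.sum_add_distrib, ← Finset.mul_sum] using h

end IsModel

end

end MomentumTracking

/-! ### Step size and the final rate -/

namespace MomentumTracking

variable {N d : ℕ} {S : Fin N → Type*} [∀ i, MeasurableSpace (S i)]
  {G : SimpleGraph (Fin N)} {W : Matrix (Fin N) (Fin N) ℝ} {p : ℝ}
  {D : ∀ i, Measure (S i)} {F : ∀ i, Param d → S i → ℝ}
  {L σ : ℝ} {Ω : Type*} [mΩ : MeasurableSpace Ω] {P : Measure Ω}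
  {ξ : ∀ i, ℕ → Ω → S i} {η β : ℝ} {x₀ : Param d}

theorem middle_term_nonneg (R : ℕ) {p β r₀ : ℝ} (hp : 0 < p) (hβ : β < 1) :
    0 ≤ r₀ ^ 2 * σ ^ 2 * L ^ 2 / (p ^ 4 * (R : ℝ) ^ 2 * (1 - β))
      * (1 + p * β ^ 2 / (1 - β)) := by
  have h1 : 0 < 1 - β := by linarith
  positivity

theorem rate_nonneg (N R : ℕ) {p L σ β r₀ : ℝ} (hp : 0 < p) (hL : 0 ≤ L) (hβ : β < 1)
    (hr : 0 ≤ r₀) : 0 ≤ rate N R p L σ β r₀ := by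
  have h1 : 0 < 1 - β := by linarith
  have := Real.rpow_nonneg (middle_term_nonneg (σ := σ) (L := L) R (r₀ := r₀) hp hβ) (1 / 3)
  unfold rate
  positivity

theorem exists_stepsize_rate {N R : ℕ} (hN : 0 < N) (hR : 0 < R) {p L σ β r₀ : ℝ} (hp : 0 < p)
    (hL : 0 < L) (hβ0 : 0 ≤ β) (hβ : β < 1) (hr : 0 < r₀) :
    ∃ a, 0 < a ∧ 36 * (L * a) ≤ p ^ 2 * (1 - β) ∧
      r₀ / (a * R) + L * σ ^ 2 / N * a
        + L ^ 2 * (1 / (p ^ 4 * (1 - β)) * (1 + p * β ^ 2 / (1 - β))) * σ ^ 2 * a ^ 2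
      ≤ 36 * rate N R p L σ β r₀ := by
  have h1 : 0 < 1 - β := by linarith
  have hR' : (0 : ℝ) < R := by exact_mod_cast hR
  have hN' : (0 : ℝ) < N := by exact_mod_cast hN
  have hmid := middle_term_nonneg (σ := σ) (L := L) R (r₀ := r₀) hp hβ
  set M₁ := Real.sqrt (r₀ * σ ^ 2 * L / (N * R)) with hM₁
  set M₃ := (r₀ ^ 2 * σ ^ 2 * L ^ 2 / (p ^ 4 * (R : ℝ) ^ 2 * (1 - β))
    * (1 + p * β ^ 2 / (1 - β))) ^ ((1 : ℝ) / 3) with hM₃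
  have hM₁0 : 0 ≤ M₁ := Real.sqrt_nonneg _
  have hM₃0 : 0 ≤ M₃ := Real.rpow_nonneg hmid _
  have e1 : M₁ ^ 2 = r₀ * (L * σ ^ 2 / N) / R := by
    rw [hM₁, Real.sq_sqrt (by positivity)]; field_simp
  have e3 : M₃ ^ 3 = r₀ ^ 2 * (L ^ 2 * (1 / (p ^ 4 * (1 - β)) * (1 + p * β ^ 2 / (1 - β)))
      * σ ^ 2) / R ^ 2 := by
    rw [hM₃, ← Real.rpow_natCast, ← Real.rpow_mul hmid]
    norm_num
    field_simp
  -- The cap `a₀` is the largest step size allowed by the absorption arguments; its term `r₀ / (a₀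
  -- R)` is `36` times the third term of the rate without the square root, a factor at least `1`.
  obtain ⟨a, ha, ha0, h⟩ := exists_stepsize (a₀ := p ^ 2 * (1 - β) / (36 * L)) hr (by positivity)
    hR' hM₁0 hM₃0 e1 e3
  refine ⟨a, ha, ?_, h.trans ?_⟩
  · rw [le_div_iff₀ (by positivity)] at ha0
    linarith
  · have e2 : r₀ / (p ^ 2 * (1 - β) / (36 * L) * R) = 36 * (L * r₀ / ((1 - β) * p ^ 2 * R)) := by
      field_simp
    have hβ2 : 0 ≤ 1 - β ^ 2 := by nlinarith
    have e4 : 1 ≤ Real.sqrt (1 + β ^ 2 / ((1 - β ^ 2) ^ 3 * p)) := by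
      rw [Real.one_le_sqrt]
      have : 0 ≤ β ^ 2 / ((1 - β ^ 2) ^ 3 * p) := by positivity
      linarith
    have e5 : 0 ≤ L * r₀ / ((1 - β) * p ^ 2 * R) := by positivity
    have e6 := le_mul_of_one_le_right e5 e4
    rw [e2, rate, ← hM₁, ← hM₃]
    linarith

theorem globalGrad_eq_zero_of_isMin [∀ i, IsProbabilityMeasure (D i)]
    (hM : IsModel G W p D F L σ P ξ) {x : Param d}
    (h : ∀ y, globalObj D F x ≤ globalObj D F y) : globalGrad D F x = 0 := by
  have hg := hasGradientAt_globalObj hM.pos hM.regular hM.L_pos.le hM.smooth hM.variance x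
  have h0 := IsLocalMin.hasFDerivAt_eq_zero (Filter.Eventually.of_forall h) hg.hasFDerivAt
  simpa using h0

/-- With step size zero the averaged parameter does not move. -/
theorem nodeAvg_stateAt_of_stepsize_zero (hM : IsModel G W p D F L σ P ξ) (r : ℕ) (ω : Ω) :
    nodeAvg (stateAt F G W 0 β x₀ ξ r ω).x = x₀ := by
  have hrun := hM.isRun 0 β x₀ ω
  induction r with
  | zero => exact hrun.nodeAvg_x_zero hM.pos
  | succ r ih => rw [hrun.nodeAvg_x_succ hM.pos hM.mixing, zero_smul, sub_zero, ih]

/-- The rate of Momentum Tracking, with the absolute constant `72000`. -/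
theorem exists_stepsize_convergence [∀ i, IsProbabilityMeasure (D i)] [IsProbabilityMeasure P]
    (hM : IsModel G W p D F L σ P ξ) {fstar : ℝ} (hf : ∀ x, fstar ≤ globalObj D F x)
    (x₀ : Param d) (hβ0 : 0 ≤ β) (hβ : β < 1) {R : ℕ} (hR : 1 ≤ R) :
    ∃ η : ℝ, 0 ≤ η ∧ (fstar < globalObj D F x₀ → 0 < η) ∧
      (R : ℝ)⁻¹ * ∑ r ∈ Finset.range R,
          ∫ ω, ‖globalGrad D F (nodeAvg (stateAt F G W η β x₀ ξ r ω).x)‖ ^ 2 ∂P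
        ≤ 72000 * rate N R p L σ β (globalObj D F x₀ - fstar) := by
  have h1 : 0 < 1 - β := by linarith
  have hR' : (0 : ℝ) < R := by exact_mod_cast hR
  have hN' : (0 : ℝ) < N := by exact_mod_cast hM.pos
  -- If `x₀` attains the lower bound, the rate vanishes, and under noise a positive step could leave
  -- the minimizer. Step size zero keeps the average there, where the gradient is zero.
  rcases (hf x₀).eq_or_lt with heq | hlt
  · refine ⟨0, le_rfl, fun h => absurd heq h.ne, ?_⟩
    simp only [nodeAvg_stateAt_of_stepsize_zero hM,
      globalGrad_eq_zero_of_isMin hM fun y => heq ▸ hf y]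
    have := rate_nonneg N R (σ := σ) hM.p_pos hM.L_pos.le hβ (sub_nonneg.2 (hf x₀))
    simp only [norm_zero, ne_eq, OfNat.ofNat_ne_zero, not_false_eq_true, zero_pow,
      integral_zero, Finset.sum_const_zero, mul_zero]
    positivity
  · obtain ⟨a, ha, haL, h⟩ := exists_stepsize_rate (σ := σ) hM.pos (R := R) hR hM.p_pos hM.L_pos
      hβ0 hβ (sub_pos.2 hlt)
    refine ⟨a * (1 - β), by positivity, fun _ => by positivity, ?_⟩
    obtain ⟨n, rfl⟩ : ∃ n, R = n + 1 := ⟨R - 1, by omega⟩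
    have hs := hM.sum_integral_sq_norm_globalGrad_le (η := a * (1 - β)) (x₀ := x₀) hf hβ0 hβ ha
      (by field_simp) haL n
    rw [inv_mul_le_iff₀ hR']
    refine hs.trans ?_
    -- A factor of the number of rounds is pulled out to match the average; the constants `2000` and
    -- `36` then multiply to `72000`.
    have e : ∀ r₀ B : ℝ, 2000 * (r₀ / a + L * a * ((n + 1 : ℕ) * σ ^ 2) / N
        + L ^ 2 * a ^ 2 * B * ((n + 1 : ℕ) * σ ^ 2)) = (n + 1 : ℕ) * (2000 *
        (r₀ / (a * (n + 1 : ℕ)) + L * σ ^ 2 / N * a + L ^ 2 * B * σ ^ 2 * a ^ 2)) := by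
      intro r₀ B
      field_simp
    rw [e]
    refine mul_le_mul_of_nonneg_left ?_ hR'.le
    linarith

end MomentumTracking

theorem theorem1 :
    ∃ C : ℝ, 0 < C ∧
      ∀ (N d : ℕ) (_ : 0 < N)
        -- the network
        (G : SimpleGraph (Fin N)) (W : Matrix (Fin N) (Fin N) ℝ)
        (_ : MomentumTracking.IsMixingMatrix G W)
        (p : ℝ) (_ : 0 < p) (_ : p ≤ 1) (_ : MomentumTracking.Contracts W d p)
        -- data distributions and losses
        (S : Fin N → Type*) [∀ i, MeasurableSpace (S i)]
        (D : ∀ i, Measure (S i)) [∀ i, IsProbabilityMeasure (D i)]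
        (F : ∀ i, MomentumTracking.Param d → S i → ℝ)
        (_ : MomentumTracking.IsRegular D F)
        (fstar : ℝ) (_ : ∀ x, fstar ≤ MomentumTracking.globalObj D F x)
        (L : ℝ) (_ : 0 < L) (_ : MomentumTracking.IsSmooth D F L)
        (σ : ℝ) (_ : MomentumTracking.HasVarianceBound D F σ)
        -- the samples
        (Ω : Type*) [MeasurableSpace Ω] (P : Measure Ω) [IsProbabilityMeasure P]
        (ξ : ∀ i, ℕ → Ω → S i) (_ : MomentumTracking.IsSampling P D ξ)
        -- initial parameter, momentum coefficient, number of rounds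
        (x₀ : MomentumTracking.Param d) (β : ℝ) (_ : 0 ≤ β) (_ : β < 1) (R : ℕ) (_ : 1 ≤ R),
        (∀ x, HasGradientAt (MomentumTracking.globalObj D F)
          (MomentumTracking.nodeAvg (fun i => MomentumTracking.localGrad D F i x)) x) ∧
        ∃ η : ℝ, 0 ≤ η ∧ (fstar < MomentumTracking.globalObj D F x₀ → 0 < η) ∧
          (∀ r < R, Integrable (fun ω => ‖gradient (MomentumTracking.globalObj D F)
            (MomentumTracking.avgParam F G W η β x₀ (fun i k => ξ i k ω) r)‖ ^ 2) P) ∧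
          (R : ℝ)⁻¹ * ∑ r ∈ Finset.range R, ∫ ω, ‖gradient (MomentumTracking.globalObj D F)
              (MomentumTracking.avgParam F G W η β x₀ (fun i k => ξ i k ω) r)‖ ^ 2 ∂P
            ≤ C * MomentumTracking.rate N R p L σ β (MomentumTracking.globalObj D F x₀ - fstar) := by
  refine ⟨72000, by norm_num, ?_⟩
  intro N d hN G W hW p hp hp1 hc S _ D _ F hF fstar hf L hL hs σ hv Ω _ P _ ξ hξ x₀ β hβ0 hβ R hR
  have hgrad := MomentumTracking.hasGradientAt_globalObj hN hF hL.le hs hv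
  have hM : MomentumTracking.IsModel G W p D F L σ P ξ :=
    ⟨hN, hW, hp, hp1, hc, hF, hL, hs, hv, hξ⟩
  obtain ⟨η, hη0, hη, h⟩ :=
    MomentumTracking.exists_stepsize_convergence hM hf x₀ hβ0 hβ hR
  refine ⟨hgrad, η, hη0, hη, ?_⟩
  simp only [fun x => (hgrad x).gradient]
  exact ⟨fun r _ => (hM.memLp_globalGrad (hM.memLp_nodeAvg_x r)).integrable_norm_pow two_ne_zero, h⟩
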